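/- \textbf{Setting.} Let $\gamma:\mathbb{R}\to\mathbb{R}^3$ be an analytic $\mathbb{Z}$-periodic parameterization of a knot (injective on $[0,1)$, with non-vanishing derivative) whose image is not contained in a plane. \emph{The sets $M$ and $M_0$.} Regard $S^3\subseteq\mathbb{R}^4\subseteq\mathbb{RP}^4$ as the boundary of the closed unit ball $B^4$. For $p\in\mathbb{RP}^4\setminus B^4$ let $T_p\subseteq S^3$ be the $2$-sphere of all points at which a line through $p$ is tangent to $S^3$. Let $M$ be the set of all $6$-tuples $(y_1,\dots,y_6)$ of distinct points of $S^3$ for which there is a point $p\in\mathbb{RP}^4\setminus B^4$ such that the lines $y_1y_4$, $y_2y_5$, $y_3y_6$ all pass through $p$, the points $y_1,y_3,y_5$ lie on one side of $T_p$ in $S^3$, and so do the points $y_2,y_4,y_6$. Let $M_0\subseteq M$ be the subset of those $6$-tuples that lie on a circle. A $6$-tuple of points of $\mathbb{R}^3$ is said to lie in $M$ or $M_0$ if its image under inverse stereographic projection $\mathbb{R}^3\to S^3$ does. \emph{One-sided points.} Let $P\subseteq\mathbb{R}^3$ be an oriented plane with $\gamma(t)\in P$. The point $\gamma(t)$ is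 positive (resp. negative) one-sided in $P$ if there is an open interval $I$ around $t$ such that $\gamma(I)$ contains points on the top (resp. bottom) side of $P$ but no points on the bottom (resp. top) side of $P$; it is one-sided if it is positive or negative one-sided. \textbf{Proposition.} Suppose that $t_1<\dots<t_6<t_1+1$ are such that $(\gamma(t_1),\dots,\gamma(t_6))\in M_0$, that these six points lie on a circle $C\subseteq\mathbb{R}^3$ of finite radius, and that at most two of them are one-sided in the plane $P$ containing $C$. Then for every $\delta>0$ there exist $t_1'<\dots<t_6'<t_1'+1$ with $|t_i'-t_i|<\delta$ for all $i$ such that the closed polygon obtained by cyclically connecting $\gamma(t_1'),\dots,\gamma(t_6')$ by line segments is a trefoil knot (of either handedness), i.e. it is simple and ambient isotopic to a standard trefoil or to its mirror image. -/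

import Mathlib

open Set Metric

noncomputable section

/-- Euclidean 3-space. -/
abbrev E3 : Type := EuclideanSpace ℝ (Fin 3)

/-- Euclidean 4-space, an affine chart of real projective 4-space. -/
abbrev E4 : Type := EuclideanSpace ℝ (Fin 4)

/-- The unit 3-sphere, the boundary of the unit ball of `E4`. -/
abbrev S3 : Type := sphere (0 : E4) 1

/-! ### Trefoil knots -/

/-- Two subsets of 3-space are ambient isotopic: there is a continuous family of homeomorphisms
of the space that starts at the identity and ends at a map carrying `K` onto `L`. -/
def AmbientIsotopic (K L : Set E3) : Prop :=
  ∃ H : unitInterval → (E3 ≃ₜ E3),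
    Continuous (fun q : unitInterval × E3 => H q.1 q.2) ∧
    H 0 = Homeomorph.refl E3 ∧ H 1 '' K = L

/-- The closed polygon with vertices `x 0, …, x 5` is simple: the vertices are distinct, and two
different edges meet at most in a common endpoint. -/
def IsSimpleHexagon (x : Fin 6 → E3) : Prop :=
  Function.Injective x ∧
    ∀ i j : Fin 6, i ≠ j →
      segment ℝ (x i) (x (i + 1)) ∩ segment ℝ (x j) (x (j + 1)) ⊆
        {x i, x (i + 1)} ∩ {x j, x (j + 1)}

/-- The closed polygonal curve `x 0 → x 1 → ⋯ → x 5 → x 0`. -/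
def closedHexagon (x : Fin 6 → E3) : Set E3 :=
  ⋃ i : Fin 6, segment ℝ (x i) (x (i + 1))

/-- The vertices of a standard stick trefoil. Denote by `e i` the edge from vertex `i` to vertex
`i + 1`. In the projection to the first two coordinates (the height being the third one) there are
exactly three crossings: `e 3` over `e 1`, `e 1` over `e 5`, and `e 5` over `e 3`. Each of
`e 1`, `e 3`, `e 5` is first an under-strand and then an over-strand, so that this is the standard
alternating diagram of a trefoil with three crossings. The rotation
`(a, b, h) ↦ (-b, a - b, h)` of order three maps vertex `i` to vertex `i + 2`. -/
def stickTrefoil : Fin 6 → E3 :=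
  ![!₂[0, -1, 1], !₂[-2, -1, -1], !₂[1, 1, 1], !₂[1, -1, -1], !₂[-1, 0, 1], !₂[1, 2, -1]]

/-- The mirror image of the standard stick trefoil in the horizontal coordinate plane. -/
def mirrorStickTrefoil : Fin 6 → E3 :=
  ![!₂[0, -1, -1], !₂[-2, -1, 1], !₂[1, 1, -1], !₂[1, -1, 1], !₂[-1, 0, -1], !₂[1, 2, 1]]

/-- Connecting the six points cyclically by line segments gives a trefoil knot, of either
handedness. -/
def FormsTrefoil (x : Fin 6 → E3) : Prop :=
  IsSimpleHexagon x ∧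
    (AmbientIsotopic (closedHexagon x) (closedHexagon stickTrefoil) ∨
      AmbientIsotopic (closedHexagon x) (closedHexagon mirrorStickTrefoil))

/-! ### The configuration spaces `M` and `M₀` -/

/-- Real projective 4-space. -/
abbrev RP4 : Type := Projectivization ℝ (E4 × ℝ)

/-- The affine chart `E4 → RP4`, `y ↦ [y : 1]`. -/
def chartRP4 (y : E4) : RP4 :=
  Projectivization.mk ℝ (y, (1 : ℝ)) (fun h => one_ne_zero (congrArg Prod.snd h))

/-- The geometric ball in projective 4-space whose boundary is the 3-sphere. -/
def ballRP4 : Set RP4 := chartRP4 '' closedBall (0 : E4) 1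

/-- The projective line through two (distinct) points. -/
def projLine (p q : RP4) : Set RP4 := {r | r.submodule ≤ p.submodule ⊔ q.submodule}

/-- The set `T_p` of the points of the 3-sphere at which a line through `p` is tangent to the
sphere, that is, the points `y` for which the line through `p` and `y` meets the sphere in no point
other than `y`. It is used for points `p` outside the ball only. -/
def tangencySet (p : RP4) : Set S3 :=
  {y | ∀ z : S3, chartRP4 z ∈ projLine p (chartRP4 y) → z = y}

/-- The points `y` and `z` of the 3-sphere lie off `T_p` and on the same side of it, that is, in the
same connected component of its complement. -/
def SameSide (p : RP4) (y z : S3) : Prop :=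
  z ∈ connectedComponentIn (tangencySet p)ᶜ y

/-- The space `M`. A 6-tuple of distinct points of the 3-sphere belongs to `M` if there is a point
`p` of projective 4-space outside the ball such that the lines joining opposite points of the tuple
(`0` and `3`, `1` and `4`, `2` and `5`) all pass through `p`, and both of the triples
`0, 2, 4` and `1, 3, 5` lie on one side of `T_p`. In other words: two different points of the tuple
lie on the same side of `T_p` or on the same one of the three lines exactly when they are not
cyclically adjacent, so that the labels form an isomorphism from the complement of the resulting
prism graph to the cycle on the six labels. -/
def spaceM : Set (Fin 6 → S3) :=
  {y | Function.Injective y ∧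
    ∃ p : RP4, p ∉ ballRP4 ∧
      (∀ i : Fin 6, p ∈ projLine (chartRP4 (y i)) (chartRP4 (y (i + 3)))) ∧
      ∀ i : Fin 6, SameSide p (y i) (y (i + 2))}

/-- The subset `M₀` of `M`: all six points lie on one circle. -/
def spaceM₀ : Set (Fin 6 → S3) :=
  {y | y ∈ spaceM ∧ EuclideanGeometry.Concyclic (range (fun i => (y i : E4)))}

instance finrank_E4 : Fact (Module.finrank ℝ E4 = 3 + 1) := ⟨by simp⟩

/-- Inverse stereographic projection from 3-space to the 3-sphere minus the pole `v`. -/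
def invStereo (v : S3) (x : E3) : S3 := (stereographic' 3 v).symm x

/-! ### Knots, circles, and one-sided points -/

/-- An analytic `ℤ`-periodic parameterization of a knot, with non-vanishing derivative. -/
structure IsAnalyticKnot (γ : ℝ → E3) : Prop where
  analytic : ∀ t : ℝ, AnalyticAt ℝ γ t
  periodic : Function.Periodic γ 1
  deriv_ne_zero : ∀ t : ℝ, deriv γ t ≠ 0
  injOn : InjOn γ (Ico 0 1)

/-- The signed height (up to a positive factor) of `x` over the plane through `c` that is
orthogonal to `n` and oriented by it. -/
def planeHeight (c n x : E3) : ℝ := inner ℝ n (x - c)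

/-- The circle with centre `c` and radius `r` in the plane through `c` orthogonal to `n`. -/
def circleIn (c n : E3) (r : ℝ) : Set E3 := {x | planeHeight c n x = 0 ∧ dist x c = r}

/-- The point `γ t` of the plane is positive one-sided: on some interval around `t`, the curve has
points on the top side of the plane but none on the bottom side. -/
def IsPositiveOneSided (γ : ℝ → E3) (c n : E3) (t : ℝ) : Prop :=
  planeHeight c n (γ t) = 0 ∧
    ∃ a b : ℝ, a < t ∧ t < b ∧
      (∃ s ∈ Ioo a b, 0 < planeHeight c n (γ s)) ∧ ¬ ∃ s ∈ Ioo a b, planeHeight c n (γ s) < 0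

/-- The point `γ t` of the plane is negative one-sided: on some interval around `t`, the curve has
points on the bottom side of the plane but none on the top side. -/
def IsNegativeOneSided (γ : ℝ → E3) (c n : E3) (t : ℝ) : Prop :=
  planeHeight c n (γ t) = 0 ∧
    ∃ a b : ℝ, a < t ∧ t < b ∧
      (∃ s ∈ Ioo a b, planeHeight c n (γ s) < 0) ∧ ¬ ∃ s ∈ Ioo a b, 0 < planeHeight c n (γ s)

/-- The point `γ t` of the plane is one-sided. -/
def IsOneSided (γ : ℝ → E3) (c n : E3) (t : ℝ) : Prop :=
  IsPositiveOneSided γ c n t ∨ IsNegativeOneSided γ c n t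

end

/-! ### Ambient isotopy -/

namespace AmbientIsotopic

variable {K L N : Set E3}

/-! The trefoil is recognised from orientations of tetrahedra. `TrefoilSigns` fixes the signs of the
nine simplices spanned by disjoint edges of the hexagon, and puts the vertices 1, 3, 5 on one side
of the plane through 0, 2, 4. The nine signs keep the polygon simple, and a path of hexagons that
keeps them is an ambient isotopy (`ambientIsotopic_of_generic_path`). After an affine map that puts
0, 2, 4 on the stick trefoil, the conditions are linear in the horizontal positions and linear in
the depths of 1, 3, 5, so straight-line deformations lead to the model. The affine map costs at most
a reflection. This gives `TrefoilSigns.formsTrefoil`.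

Membership in `M` yields positive weights with `e 0 • x 0 - e 3 • x 3 = e 2 • x 2 - e 5 • x 5 = e 4
• x 4 - e 1 • x 1`, and likewise for the weights themselves. The side condition is what makes all
weights positive, and the relations survive stereographic projection. In the plane of the circle,
the coordinates of the common difference in terms of the points 0, 2, 4 have exactly one positive
entry (`signs_of_common_product`). Such a sign pattern allows depths for 1, 3, 5 that lift the
planar hexagon to one with `TrefoilSigns` (`exists_heights_trefoilSigns`).

It remains to realise such heights along the knot. Adding an affine function of the planar position
to the heights is an affine map of space, so the heights at two of the points can be prescribed
freely (`TrefoilSigns.exists_heights_eq`). Use this at the at most two one-sided points, choosing a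
side that the curve reaches there. Near every other point the curve reaches both sides, since an
analytic curve outside every plane has no planar arc. By the intermediate value theorem the curve
attains the heights `ε * H k` near `t k` for all small `ε`. Stretching by `1 / ε` in the normal
direction gives a hexagon close to the lifted one, and the sign conditions are open and invariant
under affine maps. -/

theorem refl (K : Set E3) : AmbientIsotopic K K :=
  ⟨fun _ => Homeomorph.refl E3, continuous_snd, rfl, by simp⟩

/-- Apply the inverse of the final map and then run the isotopy backwards. Only the inverse of the
single map `H 1` occurs, so joint continuity of the inverses is not needed. -/
theorem symm (h : AmbientIsotopic K L) : AmbientIsotopic L K := by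
  obtain ⟨H, hc, h0, h1⟩ := h
  refine ⟨fun s => (H 1).symm.trans (H (unitInterval.symm s)), ?_, ?_, ?_⟩
  · have : Continuous fun q : unitInterval × E3 => (unitInterval.symm q.1, (H 1).symm q.2) :=
      (unitInterval.continuous_symm.comp continuous_fst).prodMk
        ((H 1).symm.continuous.comp continuous_snd)
    exact hc.comp this
  · simp
  · rw [← h1, ← image_comp]
    simp [h0]

theorem trans (h : AmbientIsotopic K L) (h' : AmbientIsotopic L N) : AmbientIsotopic K N := by
  obtain ⟨H, hc, h0, h1⟩ := h
  obtain ⟨H', hc', h0', h1'⟩ := h'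
  refine ⟨fun s => (H s).trans (H' s), ?_, ?_, ?_⟩
  · exact hc'.comp (continuous_fst.prodMk hc)
  · simp only [h0, h0']
    rfl
  · rw [← h1', ← h1, ← image_comp]
    rfl

theorem image (g : E3 ≃ₜ E3) (h : AmbientIsotopic K L) : AmbientIsotopic (g '' K) (g '' L) := by
  obtain ⟨H, hc, h0, h1⟩ := h
  refine ⟨fun s => g.symm.trans ((H s).trans g), ?_, ?_, ?_⟩
  · exact g.continuous.comp (hc.comp (continuous_fst.prodMk (g.symm.continuous.comp continuous_snd)))
  · ext1 y
    simp [h0]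
  · rw [← h1, ← image_comp, ← image_comp]
    congr 1
    ext1 y
    simp

theorem translate (K : Set E3) (v : E3) : AmbientIsotopic K ((fun y => y + v) '' K) := by
  refine ⟨fun s => Homeomorph.addRight ((s : ℝ) • v), ?_, ?_, ?_⟩
  · simp only [Homeomorph.coe_addRight]
    fun_prop
  · ext1 y
    simp
  · simp

end AmbientIsotopic

/-! ### Matrices acting on 3-space -/

/-- The linear action of a matrix on Euclidean 3-space. -/
def matAct (M : Matrix (Fin 3) (Fin 3) ℝ) (y : E3) : E3 := WithLp.toLp 2 (M.mulVec y.ofLp)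

theorem matAct_mul (M N : Matrix (Fin 3) (Fin 3) ℝ) (y : E3) :
    matAct (M * N) y = matAct M (matAct N y) := by
  simp [matAct, Matrix.mulVec_mulVec]

@[simp] theorem matAct_one (y : E3) : matAct 1 y = y := by
  simp [matAct]

theorem continuous_matAct {X : Type*} [TopologicalSpace X] {M : X → Matrix (Fin 3) (Fin 3) ℝ}
    {f : X → E3} (hM : Continuous M) (hf : Continuous f) :
    Continuous fun x => matAct (M x) (f x) := by
  unfold matAct
  refine (PiLp.continuous_toLp 2 _).comp (hM.matrix_mulVec ?_)
  exact (PiLp.continuous_ofLp 2 _).comp hf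

/-- An invertible matrix as a homeomorphism of 3-space. -/
noncomputable def matHomeo (M : Matrix (Fin 3) (Fin 3) ℝ) (hM : M.det ≠ 0) : E3 ≃ₜ E3 where
  toFun := matAct M
  invFun := matAct M⁻¹
  left_inv y := by rw [← matAct_mul, Matrix.nonsing_inv_mul _ (isUnit_iff_ne_zero.2 hM), matAct_one]
  right_inv y := by rw [← matAct_mul, Matrix.mul_nonsing_inv _ (isUnit_iff_ne_zero.2 hM), matAct_one]
  continuous_toFun := continuous_matAct continuous_const continuous_id
  continuous_invFun := continuous_matAct continuous_const continuous_id

/-- Every set is ambient isotopic to its image under the matrix `M`. -/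
def IsIsotopyMatrix (M : Matrix (Fin 3) (Fin 3) ℝ) : Prop :=
  ∀ K : Set E3, AmbientIsotopic K (matAct M '' K)

theorem isIsotopyMatrix_of_path (M : unitInterval → Matrix (Fin 3) (Fin 3) ℝ) (hM : Continuous M)
    (hdet : ∀ s, (M s).det ≠ 0) (h0 : M 0 = 1) : IsIsotopyMatrix (M 1) := by
  intro K
  refine ⟨fun s => matHomeo (M s) (hdet s), ?_, ?_, rfl⟩
  · exact continuous_matAct (hM.comp continuous_fst) continuous_snd
  · ext1 y
    change matAct (M 0) y = y
    rw [h0, matAct_one]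

theorem IsIsotopyMatrix.mul {M N : Matrix (Fin 3) (Fin 3) ℝ} (hM : IsIsotopyMatrix M)
    (hN : IsIsotopyMatrix N) : IsIsotopyMatrix (M * N) := by
  intro K
  have h := (hN K).trans (hM _)
  rwa [← image_comp, show matAct M ∘ matAct N = matAct (M * N) from
    funext fun y => (matAct_mul M N y).symm] at h

theorem isIsotopyMatrix_transvection (t : Matrix.TransvectionStruct (Fin 3) ℝ) :
    IsIsotopyMatrix t.toMatrix := by
  have h := isIsotopyMatrix_of_path (fun s => Matrix.transvection t.i t.j ((s : ℝ) * t.c)) ?_ ?_ ?_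
  · simpa [Matrix.TransvectionStruct.toMatrix] using h
  · unfold Matrix.transvection
    refine continuous_const.add (continuous_matrix fun i j => ?_)
    simp only [Matrix.single_apply]
    split_ifs <;> fun_prop
  · intro s
    rw [Matrix.det_transvection_of_ne _ _ t.hij]
    exact one_ne_zero
  · simp

theorem isIsotopyMatrix_diagonal_of_pos {d : Fin 3 → ℝ} (hd : ∀ i, 0 < d i) :
    IsIsotopyMatrix (Matrix.diagonal d) := by
  have h := isIsotopyMatrix_of_path
    (fun s => Matrix.diagonal (fun i => 1 + (s : ℝ) * (d i - 1))) ?_ ?_ ?_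
  · simpa using h
  · exact Continuous.matrix_diagonal (by fun_prop)
  · intro s
    rw [Matrix.det_diagonal]
    refine Finset.prod_ne_zero_iff.2 fun i _ => ?_
    nlinarith [s.2.1, s.2.2, hd i, mul_nonneg s.2.1 (hd i).le]
  · simp

/-- The reflection in the horizontal coordinate plane. -/
def mirrorMatrix : Matrix (Fin 3) (Fin 3) ℝ := Matrix.diagonal ![1, 1, -1]

theorem mirrorMatrix_mul_self : mirrorMatrix * mirrorMatrix = 1 := by
  rw [mirrorMatrix, Matrix.diagonal_mul_diagonal, ← Matrix.diagonal_one]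
  congr 1
  ext i
  fin_cases i <;> simp

theorem det_mirrorMatrix : mirrorMatrix.det = -1 := by
  simp [mirrorMatrix, Matrix.det_diagonal, Fin.prod_univ_three]

/-- Conjugating the whole isotopy by the reflection gives an isotopy again. This moves a reflection
past another factor in a product. -/
theorem IsIsotopyMatrix.mirror_conj {M : Matrix (Fin 3) (Fin 3) ℝ} (hM : IsIsotopyMatrix M) :
    IsIsotopyMatrix (mirrorMatrix * M * mirrorMatrix) := by
  intro K
  have hd : mirrorMatrix.det ≠ 0 := by rw [det_mirrorMatrix]; norm_num
  have h := (hM (matAct mirrorMatrix '' K)).image (matHomeo mirrorMatrix hd)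
  change AmbientIsotopic (matAct mirrorMatrix '' _) (matAct mirrorMatrix '' _) at h
  simpa only [← image_comp, Function.comp_def, ← matAct_mul, mirrorMatrix_mul_self, matAct_one,
    image_id', ← mul_assoc] using h

/-- The matrix becomes an isotopy matrix, possibly after a reflection. -/
def IsIsotopyOrMirror (M : Matrix (Fin 3) (Fin 3) ℝ) : Prop :=
  IsIsotopyMatrix M ∨ IsIsotopyMatrix (M * mirrorMatrix)

theorem IsIsotopyOrMirror.mul {M N : Matrix (Fin 3) (Fin 3) ℝ} (hM : IsIsotopyOrMirror M)
    (hN : IsIsotopyOrMirror N) : IsIsotopyOrMirror (M * N) := by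
  have key : ∀ A B : Matrix (Fin 3) (Fin 3) ℝ,
      A * mirrorMatrix * (mirrorMatrix * B) = A * B := fun A B => by
    rw [mul_assoc, ← mul_assoc mirrorMatrix, mirrorMatrix_mul_self, one_mul]
  rcases hM with hM | hM <;> rcases hN with hN | hN
  · exact Or.inl (hM.mul hN)
  · exact Or.inr (by simpa only [mul_assoc] using hM.mul hN)
  · refine Or.inr ?_
    have h := hM.mul hN.mirror_conj
    rwa [mul_assoc mirrorMatrix, key, ← mul_assoc] at h
  · refine Or.inl ?_
    have h := hM.mul hN.mirror_conj
    rwa [mul_assoc mirrorMatrix, key, mul_assoc N, mirrorMatrix_mul_self, mul_one] at h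

theorem isIsotopyOrMirror_single (i : Fin 3) {x : ℝ} (hx : x ≠ 0) :
    IsIsotopyOrMirror (Matrix.diagonal (Function.update 1 i x)) := by
  rcases hx.lt_or_gt with hx | hx
  · have hpos : IsIsotopyMatrix (Matrix.diagonal (Function.update 1 i (-x))) :=
      isIsotopyMatrix_diagonal_of_pos fun j => by
        by_cases h : j = i
        · subst h; simpa using hx
        · simp [h]
    -- A sign change in axis `i` differs from the reflection in the third axis by a half turn in the
    -- plane of these two axes, and the half turn is joined to the identity by rotations.
    have hturn : ∃ e : Fin 3 → ℝ, IsIsotopyMatrix (Matrix.diagonal e) ∧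
        ∀ j, Function.update (1 : Fin 3 → ℝ) i (-x) j * e j =
          Function.update (1 : Fin 3 → ℝ) i x j * ![1, 1, -1] j := by
      fin_cases i
      · refine ⟨![-1, 1, -1], ?_, fun j => by fin_cases j <;> simp⟩
        have h := isIsotopyMatrix_of_path (fun s : unitInterval =>
          !![Real.cos (Real.pi * s), 0, -Real.sin (Real.pi * s); 0, 1, 0;
            Real.sin (Real.pi * s), 0, Real.cos (Real.pi * s)]) ?_ ?_ ?_
        · convert h using 1
          ext a b
          fin_cases a <;> fin_cases b <;> simp
        · refine continuous_matrix fun a b => ?_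
          fin_cases a <;> fin_cases b <;> simp <;> fun_prop
        · intro s
          simp [Matrix.det_fin_three]
          nlinarith [Real.sin_sq_add_cos_sq (Real.pi * s)]
        · ext a b
          fin_cases a <;> fin_cases b <;> simp
      · refine ⟨![1, -1, -1], ?_, fun j => by fin_cases j <;> simp⟩
        have h := isIsotopyMatrix_of_path (fun s : unitInterval =>
          !![1, 0, 0; 0, Real.cos (Real.pi * s), -Real.sin (Real.pi * s);
            0, Real.sin (Real.pi * s), Real.cos (Real.pi * s)]) ?_ ?_ ?_
        · convert h using 1
          ext a b
          fin_cases a <;> fin_cases b <;> simp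
        · refine continuous_matrix fun a b => ?_
          fin_cases a <;> fin_cases b <;> simp <;> fun_prop
        · intro s
          simp [Matrix.det_fin_three]
          nlinarith [Real.sin_sq_add_cos_sq (Real.pi * s)]
        · ext a b
          fin_cases a <;> fin_cases b <;> simp
      · refine ⟨1, ?_, fun j => by fin_cases j <;> simp⟩
        exact isIsotopyMatrix_diagonal_of_pos (fun _ => one_pos)
    obtain ⟨e, he, hmul⟩ := hturn
    refine Or.inr ?_
    have h := hpos.mul he
    rwa [Matrix.diagonal_mul_diagonal, funext hmul, ← Matrix.diagonal_mul_diagonal] at h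
  · refine Or.inl (isIsotopyMatrix_diagonal_of_pos fun j => ?_)
    by_cases h : j = i
    · subst h; simpa using hx
    · simp [h]

/-- By Gaussian elimination an invertible matrix is a product of transvections and a diagonal
matrix. -/
theorem isIsotopyOrMirror_of_det_ne_zero (M : Matrix (Fin 3) (Fin 3) ℝ) (hM : M.det ≠ 0) :
    IsIsotopyOrMirror M := by
  refine Matrix.diagonal_transvection_induction_of_det_ne_zero IsIsotopyOrMirror M hM ?_
    (fun t => Or.inl (isIsotopyMatrix_transvection t)) fun A B _ _ hA hB => hA.mul hB
  intro d hd
  rw [Matrix.det_diagonal, Finset.prod_ne_zero_iff] at hd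
  have h := ((isIsotopyOrMirror_single 0 (hd 0 (Finset.mem_univ _))).mul
    (isIsotopyOrMirror_single 1 (hd 1 (Finset.mem_univ _)))).mul
    (isIsotopyOrMirror_single 2 (hd 2 (Finset.mem_univ _)))
  rw [Matrix.diagonal_mul_diagonal, Matrix.diagonal_mul_diagonal] at h
  convert h using 2
  ext i
  fin_cases i <;> simp

/-- Up to ambient isotopy, an affine image of a set is the set itself or its mirror image. -/
theorem ambientIsotopic_affine_image (L : E3 ≃ₗ[ℝ] E3) (v : E3) (K : Set E3) :
    AmbientIsotopic ((fun y => L y + v) '' K) K ∨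
      AmbientIsotopic ((fun y => L y + v) '' K) (matAct mirrorMatrix '' K) := by
  set e := (EuclideanSpace.basisFun (Fin 3) ℝ).toBasis
  set M := LinearMap.toMatrix e e L.toLinearMap with hMdef
  have hM : M.det ≠ 0 := by
    rw [LinearMap.det_toMatrix]
    exact L.isUnit_det'.ne_zero
  have hact : ∀ y, L y = matAct M y := by
    intro y
    ext i
    have := congrFun (LinearMap.toMatrix_mulVec_repr e e L.toLinearMap y) i
    have hy : ⇑(e.repr y) = y.ofLp := by
      ext j
      simp [e]
    rw [hy] at this
    have hLy : e.repr (L y) i = (L y) i := by simp [e]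
    rw [← hLy]
    exact this.symm
  have himg : (fun y => L y + v) '' K = (fun y => y + v) '' (matAct M '' K) := by
    rw [← image_comp]
    simp [hact]
  rw [himg]
  have htr := (AmbientIsotopic.translate (matAct M '' K) v).symm
  rcases isIsotopyOrMirror_of_det_ne_zero M hM with h | h
  · exact Or.inl (htr.trans (h K).symm)
  · refine Or.inr (htr.trans ?_)
    have h' := h (matAct mirrorMatrix '' K)
    simp only [← image_comp, Function.comp_def, ← matAct_mul, mul_assoc, mirrorMatrix_mul_self,
      mul_one] at h'
    exact h'.symm

/-! ### Isotopies from small Lipschitz displacements -/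

/-- A perturbation of the identity by a contraction is a homeomorphism. -/
noncomputable def perturbHomeo (g : E3 → E3) {c : NNReal} (hc : c < 1) (hg : LipschitzWith c g) :
    E3 ≃ₜ E3 :=
  ApproximatesLinearOn.toHomeomorph (f := fun y => y + g y)
    (f' := ContinuousLinearEquiv.refl ℝ E3) (c := c)
    (by
      intro y _ z _
      have h := hg.norm_sub_le y z
      simpa [add_sub_add_comm] using h)
    (by
      refine Or.inr ?_
      have h : ‖((ContinuousLinearEquiv.refl ℝ E3).symm : E3 →L[ℝ] E3)‖₊ = 1 := by
        simp
      rw [h]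
      simpa using hc)

@[simp] theorem perturbHomeo_apply (g : E3 → E3) {c : NNReal} (hc : c < 1)
    (hg : LipschitzWith c g) (y : E3) : perturbHomeo g hc hg y = y + g y := rfl

theorem ambientIsotopic_of_lipschitz_displacement (g : E3 → E3) {c : NNReal} (hc : c < 1)
    (hg : LipschitzWith c g) (K : Set E3) : AmbientIsotopic K ((fun y => y + g y) '' K) := by
  have hs : ∀ s : unitInterval, LipschitzWith c fun y => (s : ℝ) • g y := by
    intro s
    refine LipschitzWith.of_dist_le_mul fun y z => ?_
    rw [dist_smul₀]
    have h := hg.dist_le_mul y z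
    have h1 : ‖(s : ℝ)‖ ≤ 1 := by
      rw [Real.norm_of_nonneg s.2.1]; exact s.2.2
    nlinarith [dist_nonneg (x := g y) (y := g z), norm_nonneg (s : ℝ)]
  refine ⟨fun s => perturbHomeo _ hc (hs s), ?_, ?_, ?_⟩
  · simp only [perturbHomeo_apply]
    have := hg.continuous
    fun_prop
  · ext1 y
    simp
  · congr 1
    ext1 y
    simp

/-- The displacement is a Lipschitz function of the position on the curve, so it extends to all of
space at the cost of the factor `lipschitzExtensionConstant E3`. If the resulting constant is below
1, all partial displacements are homeomorphisms. -/
theorem ambientIsotopic_range_add {T : Type*} (P D : T → E3) (K : NNReal)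
    (hK : lipschitzExtensionConstant E3 * K < 1)
    (h : ∀ p q, ‖D p - D q‖ ≤ K * ‖P p - P q‖) :
    AmbientIsotopic (range P) (range fun p => P p + D p) := by
  have hfac : D.FactorsThrough P := by
    intro p q hpq
    have := h p q
    rw [hpq, sub_self, norm_zero, mul_zero] at this
    exact sub_eq_zero.1 (norm_le_zero_iff.1 this)
  have hf : LipschitzOnWith K (Function.extend P D 0) (range P) := by
    refine LipschitzOnWith.of_dist_le_mul ?_
    rintro _ ⟨p, rfl⟩ _ ⟨q, rfl⟩
    rw [hfac.extend_apply, hfac.extend_apply, dist_eq_norm, dist_eq_norm]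
    exact h p q
  obtain ⟨g, hg, heq⟩ := hf.extend_finite_dimension
  have := ambientIsotopic_of_lipschitz_displacement g hK hg (range P)
  rwa [← range_comp, show (fun y => y + g y) ∘ P = fun p => P p + D p from funext fun p => by
    simp [← heq (mem_range_self p), hfac.extend_apply]] at this

/-! ### Hexagons -/

/-- The point with parameter `s` on the `i`-th edge of a closed hexagon. -/
noncomputable def edgePoint (x : Fin 6 → E3) (p : Fin 6 × unitInterval) : E3 :=
  (1 - (p.2 : ℝ)) • x p.1 + (p.2 : ℝ) • x (p.1 + 1)

theorem closedHexagon_eq_range (x : Fin 6 → E3) : closedHexagon x = range (edgePoint x) := by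
  ext y
  simp only [closedHexagon, mem_iUnion, mem_range, Prod.exists, edgePoint]
  refine exists_congr fun i => ?_
  rw [segment_eq_image]
  constructor
  · rintro ⟨s, hs, rfl⟩
    exact ⟨⟨s, hs⟩, rfl⟩
  · rintro ⟨s, rfl⟩
    exact ⟨s, s.2, rfl⟩

/-- The edges `i` and `j` of a hexagon have no common vertex. -/
def EdgesApart (i j : Fin 6) : Prop := j ≠ i ∧ j ≠ i + 1 ∧ i ≠ j + 1

instance (i j : Fin 6) : Decidable (EdgesApart i j) := by unfold EdgesApart; infer_instance

/-- The endpoints of any two edges without common vertex are affinely independent. -/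
def GenericHexagon (x : Fin 6 → E3) : Prop :=
  ∀ i j, EdgesApart i j → LinearIndependent ℝ ![x (i + 1) - x i, x j - x i, x (j + 1) - x i]

theorem exists_edgesApart (i j : Fin 6) : ∃ a b : Fin 6, EdgesApart a b ∧
    ∀ k, k = i ∨ k = i + 1 ∨ k = j ∨ k = j + 1 → k = a ∨ k = a + 1 ∨ k = b ∨ k = b + 1 := by
  revert i j
  decide

/-- Any two edges, even adjacent or equal ones, have their endpoints among those of two disjoint
edges. These are affinely independent, so moving the vertices acts on differences of points of the
two edges as one linear map, of norm controlled by the motion. -/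
theorem GenericHexagon.exists_control {x : Fin 6 → E3} (hx : GenericHexagon x) (i j : Fin 6) :
    ∃ C > 0, ∀ (d : Fin 6 → E3) (η : ℝ), 0 ≤ η → (∀ k, ‖d k‖ ≤ η) →
      ∃ A : E3 →L[ℝ] E3, ‖A‖ ≤ C * η ∧ ∀ s t : unitInterval,
        A (edgePoint x (i, s) - edgePoint x (j, t)) = edgePoint d (i, s) - edgePoint d (j, t) := by
  obtain ⟨a, b, hab, hmem⟩ := exists_edgesApart i j
  set B := basisOfLinearIndependentOfCardEqFinrank (hx a b hab) (by simp) with hBdef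
  have hB : ⇑B = ![x (a + 1) - x a, x b - x a, x (b + 1) - x a] := by
    rw [hBdef, coe_basisOfLinearIndependentOfCardEqFinrank]
  obtain ⟨C, hC, hbound⟩ := B.exists_opNorm_le (F := E3)
  refine ⟨C * 2, by positivity, fun d η hη hd => ?_⟩
  set A := LinearMap.toContinuousLinearMap
    (B.constr ℝ ![d (a + 1) - d a, d b - d a, d (b + 1) - d a]) with hA
  have hAB : ∀ m, A (B m) = (![d (a + 1) - d a, d b - d a, d (b + 1) - d a] : Fin 3 → E3) m := by
    intro m
    rw [hA, LinearMap.coe_toContinuousLinearMap', Module.Basis.constr_basis]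
  have hsub : ∀ k l, ‖d k - d l‖ ≤ 2 * η := fun k l =>
    (norm_sub_le _ _).trans (by linarith [hd k, hd l])
  have hvert : ∀ k, k = a ∨ k = a + 1 ∨ k = b ∨ k = b + 1 → A (x k - x a) = d k - d a := by
    rintro k (rfl | rfl | rfl | rfl)
    · simp
    · simpa [hB] using hAB 0
    · simpa [hB] using hAB 1
    · simpa [hB] using hAB 2
  refine ⟨A, ?_, fun s t => ?_⟩
  · rw [mul_assoc]
    refine hbound (by positivity) fun m => ?_
    rw [hAB]
    fin_cases m <;> exact hsub _ _
  · have hedge : ∀ (k : Fin 6) (s : unitInterval), (k = a ∨ k = a + 1 ∨ k = b ∨ k = b + 1) →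
        (k + 1 = a ∨ k + 1 = a + 1 ∨ k + 1 = b ∨ k + 1 = b + 1) →
        A (edgePoint x (k, s) - x a) = edgePoint d (k, s) - d a := by
      intro k s h0 h1
      have e1 : ∀ z : Fin 6 → E3, edgePoint z (k, s) - z a =
          (1 - (s : ℝ)) • (z k - z a) + (s : ℝ) • (z (k + 1) - z a) := by
        intro z
        simp only [edgePoint]
        module
      rw [e1, e1, map_add, map_smul, map_smul, hvert _ h0, hvert _ h1]
    have hi := hedge i s (hmem _ (by simp)) (hmem _ (by simp))
    have hj := hedge j t (hmem _ (by simp)) (hmem _ (by simp))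
    rw [← sub_sub_sub_cancel_right _ _ (x a), map_sub, hi, hj, sub_sub_sub_cancel_right]

theorem GenericHexagon.exists_isotopic_ball {x : Fin 6 → E3} (hx : GenericHexagon x) :
    ∃ ρ > 0, ∀ x' : Fin 6 → E3, dist x' x < ρ →
      AmbientIsotopic (closedHexagon x) (closedHexagon x') := by
  choose C hC hctl using hx.exists_control
  set Cs := ∑ i, ∑ j, C i j with hCs
  have hCs0 : 0 < Cs := Finset.sum_pos (fun i _ => Finset.sum_pos (fun j _ => hC i j) (by simp))
    (by simp)
  have hle : ∀ i j, C i j ≤ Cs := fun i j =>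
    (Finset.single_le_sum (f := fun j => C i j) (fun j _ => (hC i j).le) (Finset.mem_univ j)).trans
      (Finset.single_le_sum (f := fun i => ∑ j, C i j)
        (fun i _ => Finset.sum_nonneg fun j _ => (hC i j).le) (Finset.mem_univ i))
  set κ := lipschitzExtensionConstant E3
  have hκ : 0 < κ := lipschitzExtensionConstant_pos E3
  set K : NNReal := (2 * κ)⁻¹ with hK
  have hK0 : (0 : ℝ) < K := by
    rw [NNReal.coe_pos, hK]; positivity
  refine ⟨K / Cs, by positivity, fun x' hx' => ?_⟩
  have hd : ∀ k, ‖(x' - x) k‖ ≤ K / Cs := fun k => by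
    rw [Pi.sub_apply, ← dist_eq_norm]
    exact (dist_le_pi_dist x' x k).trans hx'.le
  have h := ambientIsotopic_range_add (edgePoint x) (edgePoint (x' - x)) K ?_ ?_
  · rw [closedHexagon_eq_range, closedHexagon_eq_range]
    convert h using 3 with p
    simp only [edgePoint, Pi.sub_apply]
    module
  · rw [hK, mul_inv_rev, ← mul_assoc, mul_inv_cancel₀ hκ.ne', one_mul]
    exact inv_lt_one_of_one_lt₀ (by norm_num)
  · rintro ⟨i, s⟩ ⟨j, t⟩
    obtain ⟨A, hA, hAe⟩ := hctl i j (x' - x) (K / Cs) (by positivity) hd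
    rw [← hAe s t]
    refine (A.le_opNorm _).trans (mul_le_mul_of_nonneg_right (hA.trans ?_) (norm_nonneg _))
    calc C i j * (K / Cs) ≤ Cs * (K / Cs) := by gcongr; exact hle i j
      _ = K := by field_simp

/-- The isotopy class is locally constant along the path, hence constant. -/
theorem ambientIsotopic_of_generic_path (x : unitInterval → Fin 6 → E3) (hc : Continuous x)
    (hx : ∀ s, GenericHexagon (x s)) :
    AmbientIsotopic (closedHexagon (x 0)) (closedHexagon (x 1)) := by
  let cls : unitInterval → Prop :=
    fun s => AmbientIsotopic (closedHexagon (x 0)) (closedHexagon (x s))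
  have hloc : IsLocallyConstant cls := by
    refine (IsLocallyConstant.iff_eventually_eq cls).2 fun s => ?_
    obtain ⟨ρ, hρ, hball⟩ := (hx s).exists_isotopic_ball
    filter_upwards [hc.continuousAt (ball_mem_nhds (x s) hρ)] with u hu
    have h := hball (x u) hu
    exact propext ⟨fun h' => h'.trans h.symm, fun h' => h'.trans h⟩
  have h01 : cls 0 = cls 1 := hloc.apply_eq_of_isPreconnected isPreconnected_univ trivial trivial
  exact h01.mp (AmbientIsotopic.refl _)

theorem isSimpleHexagon_of_generic {x : Fin 6 → E3} (hx : GenericHexagon x) :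
    IsSimpleHexagon x := by
  have hind : ∀ i j, EdgesApart i j → ∀ a b c d : ℝ,
      a • x i + b • x (i + 1) + c • x j + d • x (j + 1) = 0 → a + b + c + d = 0 →
        a = 0 ∧ b = 0 ∧ c = 0 ∧ d = 0 := by
    intro i j hij a b c d h hs
    have hl := Fintype.linearIndependent_iff.1 (hx i j hij) ![b, c, d] (by
      simp only [Fin.sum_univ_three, Matrix.cons_val_zero, Matrix.cons_val_one, Matrix.cons_val]
      rw [← h, show a = -(b + c + d) by linarith]
      module)
    have h0 := hl 0
    have h1 := hl 1
    have h2 := hl 2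
    simp only [Matrix.cons_val_zero, Matrix.cons_val_one, Matrix.cons_val] at h0 h1 h2
    exact ⟨by linarith, h0, h1, h2⟩
  have hnext : ∀ k : Fin 6, EdgesApart k (k + 2) := by decide
  have h23 : ∀ k : Fin 6, k + 1 + 1 = k + 2 ∧ k + 2 + 1 = k + 3 := by decide
  -- Two adjacent edges are compared inside the simplex of the disjoint edges `i` and `i + 2`.
  have hadj : ∀ i : Fin 6, segment ℝ (x i) (x (i + 1)) ∩ segment ℝ (x (i + 1)) (x (i + 1 + 1)) ⊆
      {x (i + 1)} := by
    rintro i y ⟨⟨a, b, -, -, hab, rfl⟩, c, d, -, -, hcd, he⟩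
    rw [(h23 i).1] at he
    obtain ⟨h1, -, -, -⟩ := hind i (i + 2) (hnext i) a (b - c) (-d) 0 (by
      rw [sub_smul, ← sub_eq_zero.2 he.symm]; module) (by linarith)
    have hb : b = 1 := by linarith
    simp [h1, hb]
  constructor
  · have hne : ∀ k : Fin 6, x (k + 1) ≠ x k ∧ x (k + 2) ≠ x k ∧ x (k + 3) ≠ x k := by
      intro k
      refine ⟨fun h => ?_, fun h => ?_, fun h => ?_⟩
      · have := hind k (k + 2) (hnext k) 1 (-1) 0 0 (by rw [h]; module) (by norm_num)
        exact one_ne_zero this.1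
      · have := hind k (k + 2) (hnext k) 1 0 (-1) 0 (by rw [h]; module) (by norm_num)
        exact one_ne_zero this.1
      · have := hind k (k + 2) (hnext k) 1 0 0 (-1) (by rw [(h23 k).2, h]; module) (by norm_num)
        exact one_ne_zero this.1
    intro k l hkl
    by_contra hn
    have hcases : ∀ k l : Fin 6, k ≠ l →
        l = k + 1 ∨ l = k + 2 ∨ l = k + 3 ∨ k = l + 1 ∨ k = l + 2 := by decide
    rcases hcases k l hn with h | h | h | h | h
    · exact (hne k).1 (h ▸ hkl.symm)
    · exact (hne k).2.1 (h ▸ hkl.symm)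
    · exact (hne k).2.2 (h ▸ hkl.symm)
    · exact (hne l).1 (h ▸ hkl)
    · exact (hne l).2.1 (h ▸ hkl)
  · intro i j hij y hy
    by_cases h1 : j = i + 1
    · subst h1
      obtain rfl := hadj i hy
      simp
    by_cases h2 : i = j + 1
    · subst h2
      obtain rfl := hadj j hy.symm
      simp
    obtain ⟨⟨a, b, -, -, hab, rfl⟩, c, d, -, -, hcd, he⟩ := hy
    obtain ⟨ha, hb, -, -⟩ := hind i j ⟨Ne.symm hij, h1, h2⟩ a b (-c) (-d) (by
      rw [← sub_eq_zero.2 he.symm]; module) (by linarith)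
    simp [ha, hb] at hab

/-! ### Oriented volumes -/

/-- The oriented volume of the parallelepiped spanned by three vectors. -/
noncomputable def vol (u v w : E3) : ℝ :=
  (EuclideanSpace.basisFun (Fin 3) ℝ).toBasis.det ![u, v, w]

theorem vol_eq (u v w : E3) : vol u v w =
    u 0 * (v 1 * w 2 - v 2 * w 1) - u 1 * (v 0 * w 2 - v 2 * w 0) +
      u 2 * (v 0 * w 1 - v 1 * w 0) := by
  rw [vol, Module.Basis.det_apply, Matrix.det_fin_three]
  simp [Module.Basis.toMatrix_apply]
  ring

theorem vol_map (L : E3 →ₗ[ℝ] E3) (u v w : E3) :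
    vol (L u) (L v) (L w) = LinearMap.det L * vol u v w := by
  rw [vol, vol, ← Module.Basis.det_comp]
  congr 1
  ext i
  fin_cases i <;> rfl

theorem linearIndependent_of_vol_ne_zero {u v w : E3} (h : vol u v w ≠ 0) :
    LinearIndependent ℝ ![u, v, w] :=
  ((EuclideanSpace.basisFun (Fin 3) ℝ).toBasis.is_basis_iff_det.2 (isUnit_iff_ne_zero.2 h)).1

/-- The oriented volume of the simplex on four vertices of a hexagon, up to a factor. -/
noncomputable def orient (x : Fin 6 → E3) (i j k l : Fin 6) : ℝ :=
  vol (x j - x i) (x k - x i) (x l - x i)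

/-- Orientations, with respect to the orientation of 3-space given by the sign of `σ`, of the
simplices spanned by pairs of disjoint edges of a hexagon. -/
structure CrossingSigns (σ : ℝ) (x : Fin 6 → E3) : Prop where
  s0123 : 0 < σ * orient x 0 1 2 3
  s0134 : σ * orient x 0 1 3 4 < 0
  s0145 : 0 < σ * orient x 0 1 4 5
  s1234 : σ * orient x 1 2 3 4 < 0
  s1245 : σ * orient x 1 2 4 5 < 0
  s1250 : σ * orient x 1 2 5 0 < 0
  s2345 : 0 < σ * orient x 2 3 4 5
  s2350 : σ * orient x 2 3 5 0 < 0
  s3450 : σ * orient x 3 4 5 0 < 0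

/-- The orientations of the simplices of four vertices that distinguish a trefoil. -/
structure TrefoilSigns (σ : ℝ) (x : Fin 6 → E3) : Prop extends CrossingSigns σ x where
  s0241 : σ * orient x 0 2 4 1 < 0
  s0243 : σ * orient x 0 2 4 3 < 0
  s0245 : σ * orient x 0 2 4 5 < 0

theorem CrossingSigns.generic {σ : ℝ} {x : Fin 6 → E3} (h : CrossingSigns σ x) :
    GenericHexagon x := by
  have key : ∀ i j, orient x i (i + 1) j (j + 1) ≠ 0 →
      LinearIndependent ℝ ![x (i + 1) - x i, x j - x i, x (j + 1) - x i] ∧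
      LinearIndependent ℝ ![x (j + 1) - x j, x i - x j, x (i + 1) - x j] := by
    intro i j hij
    refine ⟨linearIndependent_of_vol_ne_zero hij, linearIndependent_of_vol_ne_zero ?_⟩
    convert hij using 1
    simp only [orient, vol_eq, PiLp.sub_apply]
    ring
  have pos : ∀ {a : ℝ}, 0 < σ * a → a ≠ 0 := fun ha => right_ne_zero_of_mul ha.ne'
  have neg : ∀ {a : ℝ}, σ * a < 0 → a ≠ 0 := fun ha => right_ne_zero_of_mul ha.ne
  have k02 := key 0 2 (pos h.s0123)
  have k03 := key 0 3 (neg h.s0134)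
  have k04 := key 0 4 (pos h.s0145)
  have k13 := key 1 3 (neg h.s1234)
  have k14 := key 1 4 (neg h.s1245)
  have k15 := key 1 5 (neg h.s1250)
  have k24 := key 2 4 (pos h.s2345)
  have k25 := key 2 5 (neg h.s2350)
  have k35 := key 3 5 (neg h.s3450)
  intro i j hij
  fin_cases i <;> fin_cases j <;>
    first
    | exact absurd hij (by decide)
    | exact k02.1 | exact k02.2 | exact k03.1 | exact k03.2 | exact k04.1 | exact k04.2
    | exact k13.1 | exact k13.2 | exact k14.1 | exact k14.2 | exact k15.1 | exact k15.2
    | exact k24.1 | exact k24.2 | exact k25.1 | exact k25.2 | exact k35.1 | exact k35.2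

theorem orient_affine (L : E3 →ₗ[ℝ] E3) {x y : Fin 6 → E3} (v : E3) (hy : ∀ i, y i = L (x i) + v)
    (i j k l : Fin 6) : orient y i j k l = LinearMap.det L * orient x i j k l := by
  simp only [orient, hy, add_sub_add_right_eq_sub, ← map_sub, vol_map]

/-- All orientations are multiplied by the determinant, which dividing `σ` by it compensates. A map
that reverses orientation flips the sign of `σ`. -/
theorem TrefoilSigns.affine {σ : ℝ} {x y : Fin 6 → E3} (h : TrefoilSigns σ x)
    (L : E3 ≃ₗ[ℝ] E3) (v : E3) (hy : ∀ i, y i = L (x i) + v) :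
    TrefoilSigns (σ / LinearMap.det L.toLinearMap) y := by
  have hL : LinearMap.det L.toLinearMap ≠ 0 := L.isUnit_det'.ne_zero
  have e : ∀ i j k l, σ / LinearMap.det L.toLinearMap * orient y i j k l = σ * orient x i j k l := by
    intro i j k l
    rw [orient_affine L.toLinearMap v hy, ← mul_assoc, div_mul_cancel₀ _ hL]
  obtain ⟨⟨_, _, _, _, _, _, _, _, _⟩, _, _, _⟩ := h
  constructor
  · constructor <;> rwa [e]
  all_goals rwa [e]

theorem TrefoilSigns.of_pos {σ : ℝ} {x : Fin 6 → E3} (h : TrefoilSigns σ x) (hσ : 0 < σ) :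
    TrefoilSigns 1 x := by
  have pos : ∀ {a : ℝ}, 0 < σ * a → 0 < 1 * a := fun ha => by
    rw [one_mul]; exact pos_of_mul_pos_right ha hσ.le
  have neg : ∀ {a : ℝ}, σ * a < 0 → 1 * a < 0 := fun {a} ha => by
    have := pos (a := -a) (by rw [mul_neg]; exact neg_pos.2 ha)
    linarith
  exact ⟨⟨pos h.s0123, neg h.s0134, pos h.s0145, neg h.s1234, neg h.s1245, neg h.s1250,
    pos h.s2345, neg h.s2350, neg h.s3450⟩, neg h.s0241, neg h.s0243, neg h.s0245⟩

/-! ### Hexagons over the top triangle of the stick trefoil -/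

/-- The hexagon that shares the vertices `0`, `2`, `4` with the standard stick trefoil, with the
other vertices given by their horizontal coordinates and their depth below those. -/
noncomputable def topHexagon (a₁ b₁ h₁ a₃ b₃ h₃ a₅ b₅ h₅ : ℝ) : Fin 6 → E3 :=
  ![!₂[0, -1, 1], !₂[a₁, b₁, 1 - h₁], !₂[1, 1, 1], !₂[a₃, b₃, 1 - h₃], !₂[-1, 0, 1],
    !₂[a₅, b₅, 1 - h₅]]

/-- The affine forms `1 + b - 2 * a`, `1 + a + b`, `1 + a - 2 * b` vanish on the lines through the
sides of the top triangle. Every condition is linear in the horizontal coordinates for fixed depths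
and vice versa, so convex combinations in either group of variables preserve it. -/
theorem crossingSigns_topHexagon_iff {a₁ b₁ h₁ a₃ b₃ h₃ a₅ b₅ h₅ : ℝ} :
    CrossingSigns 1 (topHexagon a₁ b₁ h₁ a₃ b₃ h₃ a₅ b₅ h₅) ↔
      (0 < (1 + b₁ - 2 * a₁) * h₃ - (1 + b₃ - 2 * a₃) * h₁ ∧
      (1 + a₁ + b₁) * h₃ - (1 + a₃ + b₃) * h₁ < 0 ∧
      0 < (1 + a₅ + b₅) * h₁ - (1 + a₁ + b₁) * h₅) ∧
      ((1 + a₁ - 2 * b₁) * h₃ - (1 + a₃ - 2 * b₃) * h₁ < 0 ∧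
      (1 + a₅ - 2 * b₅) * h₁ - (1 + a₁ - 2 * b₁) * h₅ < 0 ∧
      (1 + b₅ - 2 * a₅) * h₁ - (1 + b₁ - 2 * a₁) * h₅ < 0) ∧
      (0 < (1 + a₃ - 2 * b₃) * h₅ - (1 + a₅ - 2 * b₅) * h₃ ∧
      (1 + b₃ - 2 * a₃) * h₅ - (1 + b₅ - 2 * a₅) * h₃ < 0 ∧
      (1 + a₃ + b₃) * h₅ - (1 + a₅ + b₅) * h₃ < 0) := by
  have e : ∀ x : Fin 6 → E3, CrossingSigns 1 x ↔
      (0 < orient x 0 1 2 3 ∧ orient x 0 1 3 4 < 0 ∧ 0 < orient x 0 1 4 5) ∧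
      (orient x 1 2 3 4 < 0 ∧ orient x 1 2 4 5 < 0 ∧ orient x 1 2 5 0 < 0) ∧
      (0 < orient x 2 3 4 5 ∧ orient x 2 3 5 0 < 0 ∧ orient x 3 4 5 0 < 0) := fun x =>
    ⟨fun ⟨h1, h2, h3, h4, h5, h6, h7, h8, h9⟩ => by simp_all, fun h => by
      constructor <;> simp_all⟩
  rw [e]
  refine and_congr (and_congr ?_ (and_congr ?_ ?_)) (and_congr (and_congr ?_ (and_congr ?_ ?_))
    (and_congr ?_ (and_congr ?_ ?_)))
  all_goals
    simp [orient, vol_eq, topHexagon]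
    constructor <;> intro h <;> linarith

theorem convex_comb_pos {s x y : ℝ} (hs : s ∈ Icc (0 : ℝ) 1) (hx : 0 < x) (hy : 0 < y) :
    0 < (1 - s) * x + s * y := by
  rcases hs.1.eq_or_lt with rfl | h
  · simpa using hx
  · exact add_pos_of_nonneg_of_pos (mul_nonneg (by linarith [hs.2]) hx.le) (mul_pos h hy)

theorem convex_comb_neg {s x y : ℝ} (hs : s ∈ Icc (0 : ℝ) 1) (hx : x < 0) (hy : y < 0) :
    (1 - s) * x + s * y < 0 := by
  have := convex_comb_pos hs (neg_pos.2 hx) (neg_pos.2 hy)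
  linarith

theorem ambientIsotopic_topHexagon_of_horizontal {a₁ b₁ a₃ b₃ a₅ b₅ a₁' b₁' a₃' b₃' a₅' b₅' : ℝ}
    (h₁ h₃ h₅ : ℝ) (hx : CrossingSigns 1 (topHexagon a₁ b₁ h₁ a₃ b₃ h₃ a₅ b₅ h₅))
    (hy : CrossingSigns 1 (topHexagon a₁' b₁' h₁ a₃' b₃' h₃ a₅' b₅' h₅)) :
    AmbientIsotopic (closedHexagon (topHexagon a₁ b₁ h₁ a₃ b₃ h₃ a₅ b₅ h₅))
      (closedHexagon (topHexagon a₁' b₁' h₁ a₃' b₃' h₃ a₅' b₅' h₅)) := by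
  have h := ambientIsotopic_of_generic_path (fun s => topHexagon
    ((1 - (s : ℝ)) * a₁ + s * a₁') ((1 - (s : ℝ)) * b₁ + s * b₁') h₁
    ((1 - (s : ℝ)) * a₃ + s * a₃') ((1 - (s : ℝ)) * b₃ + s * b₃') h₃
    ((1 - (s : ℝ)) * a₅ + s * a₅') ((1 - (s : ℝ)) * b₅ + s * b₅') h₅) ?_ ?_
  · simpa using h
  · refine continuous_pi fun i => ?_
    fin_cases i <;> simp [topHexagon] <;> fun_prop
  · intro s
    refine CrossingSigns.generic (σ := 1) ?_
    rw [crossingSigns_topHexagon_iff] at hx hy ⊢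
    obtain ⟨⟨x1, x2, x3⟩, ⟨x4, x5, x6⟩, x7, x8, x9⟩ := hx
    obtain ⟨⟨y1, y2, y3⟩, ⟨y4, y5, y6⟩, y7, y8, y9⟩ := hy
    exact ⟨⟨by linarith [convex_comb_pos s.2 x1 y1], by linarith [convex_comb_neg s.2 x2 y2],
      by linarith [convex_comb_pos s.2 x3 y3]⟩, ⟨by linarith [convex_comb_neg s.2 x4 y4],
      by linarith [convex_comb_neg s.2 x5 y5], by linarith [convex_comb_neg s.2 x6 y6]⟩,
      by linarith [convex_comb_pos s.2 x7 y7], by linarith [convex_comb_neg s.2 x8 y8],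
      by linarith [convex_comb_neg s.2 x9 y9]⟩

theorem ambientIsotopic_topHexagon_of_vertical {h₁ h₃ h₅ h₁' h₃' h₅' : ℝ}
    (a₁ b₁ a₃ b₃ a₅ b₅ : ℝ) (hx : CrossingSigns 1 (topHexagon a₁ b₁ h₁ a₃ b₃ h₃ a₅ b₅ h₅))
    (hy : CrossingSigns 1 (topHexagon a₁ b₁ h₁' a₃ b₃ h₃' a₅ b₅ h₅')) :
    AmbientIsotopic (closedHexagon (topHexagon a₁ b₁ h₁ a₃ b₃ h₃ a₅ b₅ h₅))
      (closedHexagon (topHexagon a₁ b₁ h₁' a₃ b₃ h₃' a₅ b₅ h₅')) := by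
  have h := ambientIsotopic_of_generic_path (fun s => topHexagon
    a₁ b₁ ((1 - (s : ℝ)) * h₁ + s * h₁') a₃ b₃ ((1 - (s : ℝ)) * h₃ + s * h₃')
    a₅ b₅ ((1 - (s : ℝ)) * h₅ + s * h₅')) ?_ ?_
  · simpa using h
  · refine continuous_pi fun i => ?_
    fin_cases i <;> simp [topHexagon] <;> fun_prop
  · intro s
    refine CrossingSigns.generic (σ := 1) ?_
    rw [crossingSigns_topHexagon_iff] at hx hy ⊢
    obtain ⟨⟨x1, x2, x3⟩, ⟨x4, x5, x6⟩, x7, x8, x9⟩ := hx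
    obtain ⟨⟨y1, y2, y3⟩, ⟨y4, y5, y6⟩, y7, y8, y9⟩ := hy
    exact ⟨⟨by linarith [convex_comb_pos s.2 x1 y1], by linarith [convex_comb_neg s.2 x2 y2],
      by linarith [convex_comb_pos s.2 x3 y3]⟩, ⟨by linarith [convex_comb_neg s.2 x4 y4],
      by linarith [convex_comb_neg s.2 x5 y5], by linarith [convex_comb_neg s.2 x6 y6]⟩,
      by linarith [convex_comb_pos s.2 x7 y7], by linarith [convex_comb_neg s.2 x8 y8],
      by linarith [convex_comb_neg s.2 x9 y9]⟩

theorem stickTrefoil_eq_topHexagon : stickTrefoil = topHexagon (-2) (-1) 2 1 (-1) 2 1 2 2 := by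
  have h : (1 : ℝ) - 2 = -1 := by norm_num
  simp only [stickTrefoil, topHexagon, h]

theorem ambientIsotopic_topHexagon_stickTrefoil {a₁ b₁ h₁ a₃ b₃ h₃ a₅ b₅ h₅ : ℝ}
    (hx : CrossingSigns 1 (topHexagon a₁ b₁ h₁ a₃ b₃ h₃ a₅ b₅ h₅))
    (p₁ : 0 < h₁) (p₃ : 0 < h₃) (p₅ : 0 < h₅) :
    AmbientIsotopic (closedHexagon (topHexagon a₁ b₁ h₁ a₃ b₃ h₃ a₅ b₅ h₅))
      (closedHexagon stickTrefoil) := by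
  -- An intermediate position whose odd vertices lie on the lines extending the sides of the
  -- triangle. There the conditions hold for all positive depths, so the depths can be changed
  -- freely; the stick trefoil itself lacks this property.
  have hmid : ∀ {k₁ k₃ k₅ : ℝ}, 0 < k₁ → 0 < k₃ → 0 < k₅ →
      CrossingSigns 1 (topHexagon (-3) (-1) k₁ 1 (-2) k₃ 2 3 k₅) := by
    intro k₁ k₃ k₅ q₁ q₃ q₅
    rw [crossingSigns_topHexagon_iff]
    refine ⟨⟨?_, ?_, ?_⟩, ⟨?_, ?_, ?_⟩, ?_, ?_, ?_⟩ <;> linarith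
  have hstick : CrossingSigns 1 (topHexagon (-2) (-1) 2 1 (-1) 2 1 2 2) := by
    rw [crossingSigns_topHexagon_iff]
    refine ⟨⟨?_, ?_, ?_⟩, ⟨?_, ?_, ?_⟩, ?_, ?_, ?_⟩ <;> norm_num
  rw [stickTrefoil_eq_topHexagon]
  exact ((ambientIsotopic_topHexagon_of_horizontal h₁ h₃ h₅ hx (hmid p₁ p₃ p₅)).trans
    (ambientIsotopic_topHexagon_of_vertical _ _ _ _ _ _ (hmid p₁ p₃ p₅)
      (hmid two_pos two_pos two_pos))).trans
    (ambientIsotopic_topHexagon_of_horizontal 2 2 2 (hmid two_pos two_pos two_pos) hstick)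

/-! ### The orientations determine a trefoil -/

theorem closedHexagon_affine (L : E3 →ₗ[ℝ] E3) (v : E3) (x : Fin 6 → E3) :
    closedHexagon (fun i => L (x i) + v) = (fun z => L z + v) '' closedHexagon x := by
  rw [closedHexagon_eq_range, closedHexagon_eq_range, ← range_comp]
  congr 1
  ext1 p
  simp only [edgePoint, Function.comp_apply, map_add, map_smul]
  module

theorem closedHexagon_mirrorStickTrefoil :
    closedHexagon mirrorStickTrefoil = matAct mirrorMatrix '' closedHexagon stickTrefoil := by
  have h : ∀ i, matAct mirrorMatrix (stickTrefoil i) = mirrorStickTrefoil i := by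
    intro i
    ext k
    fin_cases i <;> fin_cases k <;>
      simp [matAct, mirrorMatrix, stickTrefoil, mirrorStickTrefoil, Matrix.mulVec_diagonal]
  have hlin : ∀ (a b : ℝ) (y z : E3), matAct mirrorMatrix (a • y + b • z) =
      a • matAct mirrorMatrix y + b • matAct mirrorMatrix z := by
    intro a b y z
    simp [matAct, Matrix.mulVec_add, Matrix.mulVec_smul]
  rw [closedHexagon_eq_range, closedHexagon_eq_range, ← range_comp]
  congr 1
  ext1 p
  simp only [edgePoint, Function.comp_apply, hlin, h]

theorem TrefoilSigns.formsTrefoil {σ : ℝ} {x : Fin 6 → E3} (h : TrefoilSigns σ x) :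
    FormsTrefoil x := by
  refine ⟨isSimpleHexagon_of_generic h.generic, ?_⟩
  have hvol : vol (x 2 - x 0) (x 4 - x 0) (x 0 - x 3) ≠ 0 := by
    intro h0
    have h1 := h.s0243
    rw [show orient x 0 2 4 3 = -vol (x 2 - x 0) (x 4 - x 0) (x 0 - x 3) by
      simp only [orient, vol_eq, PiLp.sub_apply]; ring, h0] at h1
    simp at h1
  have hvol' : vol !₂[1, 2, 0] !₂[-1, 1, 0] !₂[0, 0, 1] ≠ 0 := by
    rw [vol_eq]
    simp
    norm_num
  -- The affine map carries 0, 2, 4 to the top triangle, and the third basis vector puts vertex 3 at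
  -- depth 1. That depth then forces the transformed sign `τ` to be positive.
  set B := basisOfLinearIndependentOfCardEqFinrank (linearIndependent_of_vol_ne_zero hvol) (by simp)
    with hB
  set B' := basisOfLinearIndependentOfCardEqFinrank (linearIndependent_of_vol_ne_zero hvol')
    (by simp) with hB'
  set L : E3 ≃ₗ[ℝ] E3 := B.equiv B' (Equiv.refl _) with hLdef
  have hLB : ∀ m, L ((![x 2 - x 0, x 4 - x 0, x 0 - x 3] : Fin 3 → E3) m) =
      (![!₂[1, 2, 0], !₂[-1, 1, 0], !₂[0, 0, 1]] : Fin 3 → E3) m := by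
    intro m
    have e := B.equiv_apply m B' (Equiv.refl _)
    rw [show ⇑B = _ from coe_basisOfLinearIndependentOfCardEqFinrank _ _,
      show ⇑B' = _ from coe_basisOfLinearIndependentOfCardEqFinrank _ _] at e
    exact e
  have hL0 : L (x 2 - x 0) = !₂[1, 2, 0] := hLB 0
  have hL1 : L (x 4 - x 0) = !₂[-1, 1, 0] := hLB 1
  have hL2 : L (x 0 - x 3) = !₂[0, 0, 1] := hLB 2
  set v : E3 := !₂[0, -1, 1] - L (x 0)
  set y : Fin 6 → E3 := fun i => L (x i) + v with hy
  have hyx : ∀ i, y i = L (x i - x 0) + !₂[0, -1, 1] := by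
    intro i
    simp only [hy, v, map_sub]
    abel
  have hys := h.affine L v (fun i => rfl : ∀ i, y i = L (x i) + v)
  set τ := σ / LinearMap.det L.toLinearMap
  have htop : y = topHexagon (y 1 0) (y 1 1) (1 - y 1 2) (y 3 0) (y 3 1) (1 - y 3 2)
      (y 5 0) (y 5 1) (1 - y 5 2) := by
    have h0 : y 0 = !₂[0, -1, 1] := by simp [hyx]
    have h2 : y 2 = !₂[1, 1, 1] := by
      rw [hyx, hL0]
      ext k
      fin_cases k <;> (simp; try norm_num)
    have h4 : y 4 = !₂[-1, 0, 1] := by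
      rw [hyx, hL1]
      ext k
      fin_cases k <;> simp
    ext i k
    fin_cases i
    · simp [topHexagon, h0]
    · fin_cases k <;> simp [topHexagon]
    · simp [topHexagon, h2]
    · fin_cases k <;> simp [topHexagon]
    · simp [topHexagon, h4]
    · fin_cases k <;> simp [topHexagon]
  have hy3 : 1 - y 3 2 = 1 := by
    rw [hyx, ← neg_sub (x 0) (x 3), map_neg, hL2]
    simp
  generalize y 1 0 = a₁, y 1 1 = b₁, 1 - y 1 2 = h₁, y 3 0 = a₃, y 3 1 = b₃, 1 - y 3 2 = h₃,
    y 5 0 = a₅, y 5 1 = b₅, 1 - y 5 2 = h₅ at htop hy3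
  have hdepth : orient y 0 2 4 1 = -3 * h₁ ∧ orient y 0 2 4 3 = -3 * h₃ ∧
      orient y 0 2 4 5 = -3 * h₅ := by
    rw [htop]
    refine ⟨?_, ?_, ?_⟩ <;> simp [orient, vol_eq, topHexagon] <;> ring
  have hτ : 0 < τ := by
    have := hys.s0243
    rw [hdepth.2.1, hy3] at this
    linarith
  have hys1 : TrefoilSigns 1 y := hys.of_pos hτ
  have p1 := hys1.s0241
  have p3 := hys1.s0243
  have p5 := hys1.s0245
  rw [hdepth.1] at p1
  rw [hdepth.2.1] at p3
  rw [hdepth.2.2] at p5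
  have hyst : AmbientIsotopic (closedHexagon y) (closedHexagon stickTrefoil) := by
    have hc := hys1.toCrossingSigns
    rw [htop] at hc ⊢
    exact ambientIsotopic_topHexagon_stickTrefoil hc (by linarith) (by linarith) (by linarith)
  have himg : closedHexagon y = (fun z => L z + v) '' closedHexagon x :=
    closedHexagon_affine L.toLinearMap v x
  rcases ambientIsotopic_affine_image L v (closedHexagon x) with hl | hr
  · exact Or.inl ((himg ▸ hl).symm.trans hyst)
  · refine Or.inr ?_
    have hR : mirrorMatrix.det ≠ 0 := by rw [det_mirrorMatrix]; norm_num
    have h1 := ((himg ▸ hr).symm.trans hyst).image (matHomeo mirrorMatrix hR)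
    change AmbientIsotopic (matAct mirrorMatrix '' _) (matAct mirrorMatrix '' _) at h1
    rw [← closedHexagon_mirrorStickTrefoil] at h1
    simpa only [← image_comp, Function.comp_def, ← matAct_mul, mirrorMatrix_mul_self, matAct_one,
      image_id'] using h1

/-! ### Lines through a point outside of the ball -/

theorem exists_combination_of_mem_projLine {p : RP4} {a b : E4}
    (h : p ∈ projLine (chartRP4 a) (chartRP4 b)) :
    ∃ α β : ℝ, p.rep.1 = α • a + β • b ∧ p.rep.2 = α + β := by
  have h1 : p.rep ∈ p.submodule := by
    rw [Projectivization.submodule_eq]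
    exact Submodule.mem_span_singleton_self _
  have h2 := h h1
  rw [chartRP4, chartRP4, Projectivization.submodule_mk, Projectivization.submodule_mk,
    ← Submodule.span_union, singleton_union, Submodule.mem_span_pair] at h2
  obtain ⟨α, β, h3⟩ := h2
  refine ⟨α, β, ?_, ?_⟩
  · rw [← h3]; rfl
  · rw [← h3]; simp

theorem sq_lt_norm_sq_of_notMem_ballRP4 {p : RP4} (hp : p ∉ ballRP4) :
    p.rep.2 ^ 2 < ‖p.rep.1‖ ^ 2 := by
  by_contra! hle
  have hw : p.rep.2 ≠ 0 := by
    intro h0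
    rw [h0] at hle
    have hv : p.rep.1 = 0 := by
      rw [← norm_eq_zero]
      nlinarith [norm_nonneg p.rep.1]
    exact p.rep_nonzero (Prod.ext hv h0)
  refine hp ⟨p.rep.2⁻¹ • p.rep.1, ?_, ?_⟩
  · rw [mem_closedBall_zero_iff, norm_smul, norm_inv, Real.norm_eq_abs,
      inv_mul_le_iff₀ (abs_pos.2 hw), mul_one]
    simpa using sq_le_sq.1 hle
  · conv_rhs => rw [← p.mk_rep]
    rw [chartRP4, Projectivization.mk_eq_mk_iff']
    refine ⟨p.rep.2⁻¹, Prod.ext rfl ?_⟩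
    simp [hw]

/-- The polar form of `p`, whose zeros on the sphere are the points of tangency. -/
noncomputable def polarForm (p : RP4) (y : E4) : ℝ := inner ℝ p.rep.1 y - p.rep.2

/-- On the line from `y` to `p`, the equation of the sphere loses its linear term when the polar
form vanishes, so `y` is a double root. -/
theorem mem_tangencySet_of_polarForm_eq_zero {p : RP4} (hp : p ∉ ballRP4) {y : S3}
    (h : polarForm p y = 0) : y ∈ tangencySet p := by
  intro z hz
  have h1 : ((z : E4), (1 : ℝ)) ∈ (chartRP4 z).submodule := by
    rw [chartRP4, Projectivization.submodule_mk]
    exact Submodule.mem_span_singleton_self _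
  have h2 := hz h1
  rw [chartRP4, Projectivization.submodule_mk, Projectivization.submodule_eq,
    ← Submodule.span_union, singleton_union, Submodule.mem_span_pair] at h2
  obtain ⟨a, b, h3⟩ := h2
  have hz1 : (z : E4) = a • p.rep.1 + b • (y : E4) := (congrArg Prod.fst h3).symm
  have hz2 : 1 = a * p.rep.2 + b := by simpa using (congrArg Prod.snd h3).symm
  have hzn : ‖(z : E4)‖ ^ 2 = 1 := by simp
  have hyn : ‖(y : E4)‖ ^ 2 = 1 := by simp
  have hout := sq_lt_norm_sq_of_notMem_ballRP4 hp
  rw [hz1, norm_add_sq_real, inner_smul_left, inner_smul_right, norm_smul, norm_smul, mul_pow,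
    mul_pow, hyn, sub_eq_zero.1 h] at hzn
  simp only [Real.norm_eq_abs, sq_abs, RCLike.conj_to_real] at hzn
  have ha : a = 0 := by
    have : a ^ 2 * (‖p.rep.1‖ ^ 2 - p.rep.2 ^ 2) = 0 := by
      have hb : b = 1 - a * p.rep.2 := by linarith
      rw [hb] at hzn
      linarith
    rcases mul_eq_zero.1 this with h0 | h0
    · exact pow_eq_zero_iff two_ne_zero |>.1 h0
    · linarith
  have hb : b = 1 := by rw [ha] at hz2; linarith
  ext1
  rw [hz1, ha, hb]
  simp

theorem SameSide.polarForm_mul_pos {p : RP4} (hp : p ∉ ballRP4) {y z : S3}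
    (h : SameSide p y z) : 0 < polarForm p y * polarForm p z := by
  have hy : y ∈ (tangencySet p)ᶜ := connectedComponentIn_nonempty_iff.1 ⟨z, h⟩
  have hne : ∀ u ∈ connectedComponentIn (tangencySet p)ᶜ y, polarForm p u ≠ 0 := fun u hu h0 =>
    connectedComponentIn_subset _ _ hu (mem_tangencySet_of_polarForm_eq_zero hp h0)
  have hpre : IsPreconnected (connectedComponentIn (tangencySet p)ᶜ y) :=
    isPreconnected_connectedComponentIn
  have hcont : Continuous fun u : S3 => polarForm p u := by
    unfold polarForm
    fun_prop
  have hyy := mem_connectedComponentIn hy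
  by_contra! hle
  have h0 : (0 : ℝ) ∈ (fun u : S3 => polarForm p u) '' connectedComponentIn (tangencySet p)ᶜ y := by
    rcases mul_nonpos_iff.1 hle with ⟨h1, h2⟩ | ⟨h1, h2⟩
    · exact hpre.intermediate_value h hyy hcont.continuousOn ⟨h2, h1⟩
    · exact hpre.intermediate_value hyy h hcont.continuousOn ⟨h1, h2⟩
  obtain ⟨u, hu, hu0⟩ := h0
  exact hne u hu hu0

/-- Positive weights for which the three lines joining opposite points of a 6-tuple meet in a
common point, with opposite points lying in the same direction from it. -/
def HasCommonDifference {E : Type*} [AddCommGroup E] [Module ℝ E] (x : Fin 6 → E)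
    (e : Fin 6 → ℝ) : Prop :=
  (∀ i, 0 < e i) ∧ ∃ (q : E) (w : ℝ),
    (e 0 • x 0 - e 3 • x 3 = q ∧ e 0 - e 3 = w) ∧
    (e 2 • x 2 - e 5 • x 5 = q ∧ e 2 - e 5 = w) ∧
    (e 4 • x 4 - e 1 • x 1 = q ∧ e 4 - e 1 = w)

/-- Since `a`, `b` are unit vectors, the Lorentzian square of `p` is `2 * α * β * (⟪a, b⟫ - 1)`,
which is positive outside the ball. The sign of `β` records the side of `a`. -/
theorem polarForm_of_combination {p : RP4} (hp : p ∉ ballRP4) {a b : S3} (hab : a ≠ b) {α β : ℝ}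
    (h1 : p.rep.1 = α • (a : E4) + β • (b : E4)) (h2 : p.rep.2 = α + β) :
    α * β < 0 ∧ ∃ c < 0, polarForm p a = β * c := by
  have ha : inner ℝ (a : E4) a = 1 := by rw [real_inner_self_eq_norm_sq]; simp
  have hb : inner ℝ (b : E4) b = 1 := by rw [real_inner_self_eq_norm_sq]; simp
  have hlt : inner ℝ (a : E4) b < 1 := by
    refine inner_lt_one_iff_real_of_norm_eq_one (by simp) (by simp) |>.2 ?_
    exact fun h => hab (Subtype.ext h)
  have hout := sq_lt_norm_sq_of_notMem_ballRP4 hp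
  rw [← real_inner_self_eq_norm_sq, h1, h2] at hout
  simp only [inner_add_left, inner_add_right, inner_smul_left, inner_smul_right, ha, hb,
    RCLike.conj_to_real, real_inner_comm (a : E4) (b : E4)] at hout
  refine ⟨by nlinarith, inner ℝ (a : E4) b - 1, by linarith, ?_⟩
  rw [polarForm, h1, h2, inner_add_left, inner_smul_left, inner_smul_left, ha,
    real_inner_comm (a : E4) (b : E4)]
  simp only [RCLike.conj_to_real]
  ring

theorem exists_hasCommonDifference_of_mem_spaceM {y : Fin 6 → S3} (hy : y ∈ spaceM) :
    ∃ e, HasCommonDifference (fun i => (y i : E4)) e := by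
  obtain ⟨hinj, p, hp, hline, hside⟩ := hy
  obtain ⟨α₀, β₀, h01, h02⟩ := exists_combination_of_mem_projLine (hline 0)
  obtain ⟨α₂, β₂, h21, h22⟩ := exists_combination_of_mem_projLine (hline 2)
  obtain ⟨α₄, β₄, h41, h42⟩ := exists_combination_of_mem_projLine (hline 4)
  obtain ⟨m₀, c₀, hc₀, f₀⟩ := polarForm_of_combination hp (hinj.ne (by decide)) h01 h02
  obtain ⟨m₂, c₂, hc₂, f₂⟩ := polarForm_of_combination hp (hinj.ne (by decide)) h21 h22
  obtain ⟨m₄, c₄, hc₄, f₄⟩ := polarForm_of_combination hp (hinj.ne (by decide)) h41 h42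
  have s02 := (hside 0).polarForm_mul_pos hp
  have s24 := (hside 2).polarForm_mul_pos hp
  change 0 < polarForm p (y 0) * polarForm p (y 2) at s02
  change 0 < polarForm p (y 2) * polarForm p (y 4) at s24
  rw [f₀, f₂] at s02
  rw [f₂, f₄] at s24
  have b02 : 0 < β₀ * β₂ := by
    have := mul_pos_of_neg_of_neg hc₀ hc₂
    by_contra! hle
    nlinarith
  have b24 : 0 < β₂ * β₄ := by
    have := mul_pos_of_neg_of_neg hc₂ hc₄
    by_contra! hle
    nlinarith
  -- The representative of `p` is only defined up to scaling; `s` normalises its sign so that the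
  -- coefficients of 3, 5, 1 are positive.
  have key : ∀ s : ℝ, s * s = 1 → 0 < s * β₀ →
      ∃ e, HasCommonDifference (fun i => (y i : E4)) e := by
    intro s hs hb0
    have hs0 : s ≠ 0 := by rintro rfl; simp at hs
    have hb2 : 0 < s * β₂ := by
      by_contra! hle
      nlinarith [mul_nonneg hb0.le (neg_nonneg.2 hle)]
    have hb4 : 0 < s * β₄ := by
      by_contra! hle
      nlinarith [mul_nonneg hb2.le (neg_nonneg.2 hle)]
    have ha : ∀ {α β : ℝ}, α * β < 0 → 0 < s * β → 0 < -s * α := by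
      intro α β hm hb
      by_contra! hle
      nlinarith [mul_nonneg hb.le (sub_nonneg.2 hle)]
    refine ⟨![-s * α₀, s * β₄, -s * α₂, s * β₀, -s * α₄, s * β₂], ?_, -s • p.rep.1,
      -s * p.rep.2, ⟨?_, ?_⟩, ⟨?_, ?_⟩, ?_, ?_⟩
    · intro i
      fin_cases i
      exacts [ha m₀ hb0, hb4, ha m₂ hb2, hb0, ha m₄ hb4, hb2]
    · rw [h01]
      change (-s * α₀) • (y 0 : E4) - (s * β₀) • (y 3 : E4) = -s • (α₀ • (y 0 : E4) + β₀ • (y 3 : E4))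
      module
    · rw [h02]
      change -s * α₀ - s * β₀ = _
      ring
    · rw [h21]
      change (-s * α₂) • (y 2 : E4) - (s * β₂) • (y 5 : E4) = -s • (α₂ • (y 2 : E4) + β₂ • (y 5 : E4))
      module
    · rw [h22]
      change -s * α₂ - s * β₂ = _
      ring
    · rw [h41]
      change (-s * α₄) • (y 4 : E4) - (s * β₄) • (y 1 : E4) = -s • (α₄ • (y 4 : E4) + β₄ • (y 1 : E4))
      module
    · rw [h42]
      change -s * α₄ - s * β₄ = _
      ring
  rcases lt_trichotomy β₀ 0 with h | h | h
  · exact key (-1) (by norm_num) (by linarith)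
  · simp [h] at b02
  · exact key 1 (by norm_num) (by linarith)

/-! ### Stereographic projection -/

theorem exists_invStereo_eq (v : S3) : ∃ U : E3 →ₗᵢ[ℝ] E4, (∀ x, inner ℝ (v : E4) (U x) = 0) ∧
    ∀ x, (invStereo v x : E4) = (‖x‖ ^ 2 + 4)⁻¹ • ((4 : ℝ) • U x + (‖x‖ ^ 2 - 4) • (v : E4)) := by
  set U₀ := (OrthonormalBasis.fromOrthogonalSpanSingleton (𝕜 := ℝ) 3
    (ne_zero_of_mem_unit_sphere v)).repr
  refine ⟨(Submodule.subtypeₗᵢ _).comp U₀.symm.toLinearIsometry, fun x => ?_, fun x => ?_⟩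
  · exact Submodule.mem_orthogonal_singleton_iff_inner_right.1 (U₀.symm x).2
  · rw [invStereo, stereographic'_symm_apply]
    have hn : ‖((U₀.symm x : _) : E4)‖ = ‖x‖ := by
      rw [Submodule.norm_coe, LinearIsometryEquiv.norm_map]
    simp only [smul_add, smul_smul]
    rw [hn]
    rfl

/-- Stereographic projection is linear in homogeneous coordinates: both `(e / (‖x‖ ^ 2 + 4)) • x`
and the new weight depend linearly on the weighted point of the sphere and its weight `e`. Equal
differences therefore stay equal. -/
theorem HasCommonDifference.of_invStereo {v : S3} {x : Fin 6 → E3} {e : Fin 6 → ℝ}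
    (h : HasCommonDifference (fun i => (invStereo v (x i) : E4)) e) :
    HasCommonDifference x fun i => e i * (‖x i‖ ^ 2 + 4)⁻¹ := by
  obtain ⟨U, hU, hstereo⟩ := exists_invStereo_eq v
  obtain ⟨he, q, w, ⟨h01, h02⟩, ⟨h21, h22⟩, h41, h42⟩ := h
  have hpos : ∀ z : E3, 0 < ‖z‖ ^ 2 + 4 := fun z => by positivity
  refine ⟨fun i => mul_pos (he i) (inv_pos.2 (hpos _)), ?_⟩
  have hvv : inner ℝ (v : E4) v = 1 := by rw [real_inner_self_eq_norm_sq]; simp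
  have main : ∀ i j : Fin 6, e i • (invStereo v (x i) : E4) - e j • (invStereo v (x j) : E4) = q →
      e i - e j = w →
      U ((e i * (‖x i‖ ^ 2 + 4)⁻¹) • x i - (e j * (‖x j‖ ^ 2 + 4)⁻¹) • x j) =
        (1 / 4 : ℝ) • (q - inner ℝ (v : E4) q • (v : E4)) ∧
      e i * (‖x i‖ ^ 2 + 4)⁻¹ - e j * (‖x j‖ ^ 2 + 4)⁻¹ = (w - inner ℝ (v : E4) q) / 8 := by
    intro i j hq hw
    have hin : ∀ i, inner ℝ (v : E4) (e i • (invStereo v (x i) : E4)) =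
        e i - 8 * (e i * (‖x i‖ ^ 2 + 4)⁻¹) := by
      intro i
      rw [hstereo, inner_smul_right, inner_smul_right, inner_add_right, inner_smul_right,
        inner_smul_right, hU, hvv]
      field_simp [(hpos (x i)).ne']
      ring
    have hinq : inner ℝ (v : E4) q = w - 8 * (e i * (‖x i‖ ^ 2 + 4)⁻¹ - e j * (‖x j‖ ^ 2 + 4)⁻¹) := by
      rw [← hq, inner_sub_right, hin, hin, ← hw]
      ring
    constructor
    · have hUi : ∀ i, U ((e i * (‖x i‖ ^ 2 + 4)⁻¹) • x i) = (1 / 4 : ℝ) •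
          (e i • (invStereo v (x i) : E4) -
            inner ℝ (v : E4) (e i • (invStereo v (x i) : E4)) • (v : E4)) := by
        intro i
        rw [hin, hstereo, map_smul]
        have : e i - 8 * (e i * (‖x i‖ ^ 2 + 4)⁻¹) =
            e i * (‖x i‖ ^ 2 + 4)⁻¹ * (‖x i‖ ^ 2 - 4) := by
          field_simp [(hpos (x i)).ne']
          ring
        rw [this]
        module
      rw [map_sub, hUi, hUi, ← hq, inner_sub_right]
      module
    · rw [hinq]
      ring
  obtain ⟨a0, b0⟩ := main 0 3 h01 h02
  obtain ⟨a2, b2⟩ := main 2 5 h21 h22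
  obtain ⟨a4, b4⟩ := main 4 1 h41 h42
  exact ⟨_, _, ⟨rfl, b0⟩, ⟨U.injective (a2.trans a0.symm), b2⟩,
    U.injective (a4.trans a0.symm), b4⟩

/-! ### Choosing the heights -/

/-- A hexagon in coordinates: its vertices `0`, `2`, `4` are `0` and two standard basis vectors, and
the other ones are determined by weights, depths, and the coordinates of the common difference. -/
noncomputable def weightedHexagon (e : Fin 6 → ℝ) (qb qc k₀ k₁ k₂ : ℝ) : Fin 6 → E3 :=
  ![!₂[0, 0, 0], !₂[-qb * e 2 / e 1, (1 - qc) * e 4 / e 1, -k₂ / e 1], !₂[1, 0, 0],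
    !₂[-qb * e 2 / e 3, -qc * e 4 / e 3, -k₀ / e 3], !₂[0, 1, 0],
    !₂[(1 - qb) * e 2 / e 5, -qc * e 4 / e 5, -k₁ / e 5]]

/-- Conditions on depths which make the hexagon with common difference `(qa, qb, qc)` a trefoil. -/
structure GoodDepths (qa qb qc k₀ k₁ k₂ : ℝ) : Prop where
  p₀ : 0 < k₀
  p₁ : 0 < k₁
  p₂ : 0 < k₂
  c02 : 0 < k₀ + qc * (k₂ - k₀)
  b12 : 0 < k₂ + qb * (k₁ - k₂)
  a02 : 0 < k₂ + qa * (k₀ - k₂)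
  c12 : 0 < k₁ + qc * (k₂ - k₁)
  a01 : 0 < k₁ + qa * (k₀ - k₁)
  b01 : 0 < k₀ + qb * (k₁ - k₀)
  b20 : qb * (k₂ - k₀) < 0
  a12 : qa * (k₁ - k₂) < 0
  c01 : qc * (k₀ - k₁) < 0

/-- The last three conditions prescribe the order of the depths. If all three signs agreed, the
order would be cyclic and impossible; with one positive sign it is consistent. -/
theorem exists_goodDepths {qa qb qc : ℝ} (h : (0 < qa ∧ qb < 0 ∧ qc < 0) ∨
    (qa < 0 ∧ 0 < qb ∧ qc < 0) ∨ (qa < 0 ∧ qb < 0 ∧ 0 < qc)) :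
    ∃ k₀ k₁ k₂, GoodDepths qa qb qc k₀ k₁ k₂ := by
  -- The depths differ by at most 2, so this size makes the remaining conditions hold.
  set N := 1 + 2 * (|qa| + |qb| + |qc|) with hN
  have ha := abs_nonneg qa
  have hb := abs_nonneg qb
  have hc := abs_nonneg qc
  have ha1 := le_abs_self qa
  have hb1 := le_abs_self qb
  have hc1 := le_abs_self qc
  have ha2 := neg_abs_le qa
  have hb2 := neg_abs_le qb
  have hc2 := neg_abs_le qc
  rcases h with ⟨h1, h2, h3⟩ | ⟨h1, h2, h3⟩ | ⟨h1, h2, h3⟩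
  · refine ⟨N + 1, N, N + 2, ?_⟩
    constructor <;> linarith
  · refine ⟨N + 2, N + 1, N, ?_⟩
    constructor <;> linarith
  · refine ⟨N, N + 2, N + 1, ?_⟩
    constructor <;> linarith

/-- Each crossing orientation is, up to sign, a positive quotient of weights times the expression in
one of the conditions on the depths. -/
theorem GoodDepths.trefoilSigns {qa qb qc k₀ k₁ k₂ : ℝ} (h : GoodDepths qa qb qc k₀ k₁ k₂)
    {e : Fin 6 → ℝ} (he : ∀ i, 0 < e i) {w : ℝ} (hw : w = qa * e 0 + qb * e 2 + qc * e 4)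
    (h03 : e 0 - e 3 = w) (h25 : e 2 - e 5 = w) (h41 : e 4 - e 1 = w) :
    TrefoilSigns 1 (weightedHexagon e qb qc k₀ k₁ k₂) := by
  set x := weightedHexagon e qb qc k₀ k₁ k₂ with hx
  have e0 := he 0
  have e1 := he 1
  have e2 := he 2
  have e3 := he 3
  have e4 := he 4
  have e5 := he 5
  have o0123 : orient x 0 1 2 3 = e 4 / (e 1 * e 3) * (k₀ + qc * (k₂ - k₀)) := by
    simp [orient, vol_eq, hx, weightedHexagon]
    field_simp
    ring
  have o0134 : orient x 0 1 3 4 = e 2 / (e 1 * e 3) * (qb * (k₂ - k₀)) := by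
    simp [orient, vol_eq, hx, weightedHexagon]
    field_simp
    ring
  have o0145 : orient x 0 1 4 5 = e 2 / (e 1 * e 5) * (k₂ + qb * (k₁ - k₂)) := by
    simp [orient, vol_eq, hx, weightedHexagon]
    field_simp
    ring
  have o1234 : orient x 1 2 3 4 = -(e 0 / (e 1 * e 3) * (k₂ + qa * (k₀ - k₂))) := by
    simp [orient, vol_eq, hx, weightedHexagon]
    field_simp
    grind
  have o1245 : orient x 1 2 4 5 = e 0 / (e 1 * e 5) * (qa * (k₁ - k₂)) := by
    simp [orient, vol_eq, hx, weightedHexagon]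
    field_simp
    grind
  have o1250 : orient x 1 2 5 0 = -(e 4 / (e 1 * e 5) * (k₁ + qc * (k₂ - k₁))) := by
    simp [orient, vol_eq, hx, weightedHexagon]
    field_simp
    grind
  have o2345 : orient x 2 3 4 5 = e 0 / (e 3 * e 5) * (k₁ + qa * (k₀ - k₁)) := by
    simp [orient, vol_eq, hx, weightedHexagon]
    field_simp
    grind
  have o2350 : orient x 2 3 5 0 = e 4 / (e 3 * e 5) * (qc * (k₀ - k₁)) := by
    simp [orient, vol_eq, hx, weightedHexagon]
    field_simp
    grind
  have o3450 : orient x 3 4 5 0 = -(e 2 / (e 3 * e 5) * (k₀ + qb * (k₁ - k₀))) := by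
    simp [orient, vol_eq, hx, weightedHexagon]
    field_simp
    grind
  have o0241 : orient x 0 2 4 1 = -(k₂ / e 1) := by
    simp [orient, vol_eq, hx, weightedHexagon, neg_div]
  have o0243 : orient x 0 2 4 3 = -(k₀ / e 3) := by
    simp [orient, vol_eq, hx, weightedHexagon, neg_div]
  have o0245 : orient x 0 2 4 5 = -(k₁ / e 5) := by
    simp [orient, vol_eq, hx, weightedHexagon, neg_div]
  obtain ⟨p₀, p₁, p₂, c02, b12, a02, c12, a01, b01, b20, a12, c01⟩ := h
  constructor
  · constructor <;> rw [one_mul]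
    · rw [o0123]; positivity
    · rw [o0134]; exact mul_neg_of_pos_of_neg (by positivity) b20
    · rw [o0145]; positivity
    · rw [o1234, neg_lt_zero]; positivity
    · rw [o1245]; exact mul_neg_of_pos_of_neg (by positivity) a12
    · rw [o1250, neg_lt_zero]; positivity
    · rw [o2345]; positivity
    · rw [o2350]; exact mul_neg_of_pos_of_neg (by positivity) c01
    · rw [o3450, neg_lt_zero]; positivity
  · rw [one_mul, o0241, neg_lt_zero]; positivity
  · rw [one_mul, o0243, neg_lt_zero]; positivity
  · rw [one_mul, o0245, neg_lt_zero]; positivity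

/-- Two nonnegative coordinates would make one of the three sums nonpositive, so at most one is
nonnegative. As the sum is 2, that one exists and is positive. -/
theorem signs_of_common_product {a b c qa qb qc M : ℝ} (ha : a < 0) (hb : b < 0) (hc : c < 0)
    (hM : 0 < M) (fa : c * qb + b * qc = M) (fb : c * qa + a * qc = M) (fc : b * qa + a * qb = M)
    (hs : qa + qb + qc = 2) :
    (0 < qa ∧ qb < 0 ∧ qc < 0) ∨ (qa < 0 ∧ 0 < qb ∧ qc < 0) ∨ (qa < 0 ∧ qb < 0 ∧ 0 < qc) := by
  have key : ∀ {s t u v : ℝ}, s < 0 → t < 0 → s * u + t * v = M → 0 ≤ u → v < 0 := by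
    intro s t u v hs ht h hu
    by_contra! hv
    nlinarith [mul_nonneg (neg_pos.2 hs).le hu, mul_nonneg (neg_pos.2 ht).le hv]
  rcases lt_or_ge qa 0 with h1 | h1
  · rcases lt_or_ge qb 0 with h2 | h2
    · exact Or.inr (Or.inr ⟨h1, h2, by linarith⟩)
    · have h3 := key hc hb fa h2
      exact Or.inr (Or.inl ⟨h1, by linarith, h3⟩)
  · have h2 := key hb ha fc h1
    have h3 := key hc ha fb h1
    exact Or.inl ⟨by linarith, h2, h3⟩

/-- A line meets a sphere in at most two points, so three distinct points of the circle are not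
collinear. -/
theorem linearIndependent_of_circle {p₀ p₂ p₄ n : E3} (hn : n ≠ 0) {r : ℝ}
    (h0 : inner ℝ n p₀ = 0) (h2 : inner ℝ n p₂ = 0) (h4 : inner ℝ n p₄ = 0)
    (r0 : ‖p₀‖ = r) (r2 : ‖p₂‖ = r) (r4 : ‖p₄‖ = r) (d02 : p₀ ≠ p₂) (d04 : p₀ ≠ p₄)
    (d24 : p₂ ≠ p₄) : LinearIndependent ℝ ![p₂ - p₀, p₄ - p₀, n] := by
  have hnn : 0 < inner ℝ n n := real_inner_self_pos.2 hn
  have key : ∀ {u v : E3}, ‖u‖ = r → ‖v‖ = r → u ≠ p₀ → v ≠ p₀ → u ≠ v → ‖p₀‖ = r →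
      ∀ s t : ℝ, s • (u - p₀) + t • (v - p₀) = 0 → s = 0 := by
    intro u v hu hv hu0 hv0 huv hp s t hst
    by_contra hs
    have hu' : u = p₀ + (-t / s) • (v - p₀) := by
      have : u - p₀ = (-t / s) • (v - p₀) := by
        rw [div_eq_inv_mul, mul_smul, neg_smul, ← eq_neg_of_add_eq_zero_left hst, smul_smul,
          inv_mul_cancel₀ hs, one_smul]
      rw [← this]; abel
    set c := -t / s
    set d := v - p₀
    have hd : 0 < ‖d‖ ^ 2 := by
      have : 0 < ‖d‖ := norm_pos_iff.2 (sub_ne_zero.2 hv0)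
      positivity
    have e1 : ‖p₀ + d‖ ^ 2 = r ^ 2 := by rw [show p₀ + d = v by simp [d], hv]
    have e2 : ‖p₀ + c • d‖ ^ 2 = r ^ 2 := by rw [← hu', hu]
    rw [norm_add_sq_real, hp] at e1 e2
    rw [norm_smul, mul_pow, Real.norm_eq_abs, sq_abs, inner_smul_right] at e2
    have e3 : c * (c - 1) * ‖d‖ ^ 2 = 0 := by linear_combination e2 - c * e1
    rcases mul_eq_zero.1 e3 with e4 | e4
    · rcases mul_eq_zero.1 e4 with e5 | e5
      · exact hu0 (by rw [hu', e5]; simp)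
      · exact huv (by rw [hu', show c = 1 by linarith]; simp [d])
    · exact hd.ne' e4
  rw [Fintype.linearIndependent_iff]
  intro g hg
  simp only [Fin.sum_univ_three, Matrix.cons_val_zero, Matrix.cons_val_one, Matrix.cons_val] at hg
  have hg2 : g 2 = 0 := by
    have h := congrArg (fun z => inner ℝ n z) hg
    simp only [inner_add_right, inner_smul_right, inner_sub_right, h0, h2, h4, inner_zero_right] at h
    have : g 2 * inner ℝ n n = 0 := by linarith
    exact (mul_eq_zero.1 this).resolve_right hnn.ne'
  rw [hg2, zero_smul, add_zero] at hg
  have hg0 := key r2 r4 d02.symm d04.symm d24 r0 _ _ hg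
  have hg1 := key r4 r2 d04.symm d02.symm d24.symm r0 _ _ ((add_comm _ _).trans hg)
  intro i
  fin_cases i
  exacts [hg0, hg1, hg2]

/-- Six points of a circle whose opposite chords are concurrent become the vertices of a trefoil when
they are lifted suitably in the normal direction. -/
theorem exists_heights_trefoilSigns {p : Fin 6 → E3} {n : E3} (hn : n ≠ 0)
    (hpn : ∀ i, inner ℝ n (p i) = 0) {r : ℝ} (hpr : ∀ i, ‖p i‖ = r)
    (hinj : Function.Injective p) {e : Fin 6 → ℝ} (he : HasCommonDifference p e) :
    ∃ (H : Fin 6 → ℝ) (σ : ℝ), TrefoilSigns σ fun i => p i + H i • n := by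
  obtain ⟨hpos, q, w, ⟨a1, a2⟩, ⟨b1, b2⟩, c1, c2⟩ := he
  have hd : ∀ {i j : Fin 6}, i ≠ j → p i ≠ p j := fun h => hinj.ne h
  have hli := linearIndependent_of_circle hn (hpn 0) (hpn 2) (hpn 4) (hpr 0) (hpr 2) (hpr 4)
    (hd (by decide)) (hd (by decide)) (hd (by decide))
  set B := basisOfLinearIndependentOfCardEqFinrank hli (by simp)
  have hB : ⇑B = ![p 2 - p 0, p 4 - p 0, n] := coe_basisOfLinearIndependentOfCardEqFinrank _ _
  have hqn : inner ℝ n q = 0 := by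
    rw [← a1, inner_sub_right, inner_smul_right, inner_smul_right, hpn, hpn]; simp
  have e0 := hpos 0
  have e2 := hpos 2
  have e4 := hpos 4
  obtain ⟨qa, qb, qc, hq, hw⟩ : ∃ qa qb qc : ℝ,
      q = (qa * e 0) • p 0 + (qb * e 2) • p 2 + (qc * e 4) • p 4 ∧
      w = qa * e 0 + qb * e 2 + qc * e 4 := by
    set s := B.repr (q - w • p 0) 0 with hs
    set t := B.repr (q - w • p 0) 1 with ht
    set u := B.repr (q - w • p 0) 2 with hu
    have hsum := B.sum_repr (q - w • p 0)
    rw [Fin.sum_univ_three, ← hs, ← ht, ← hu, hB] at hsum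
    simp only [Matrix.cons_val_zero, Matrix.cons_val_one, Matrix.cons_val] at hsum
    have hu0 : u = 0 := by
      have h := congrArg (fun z => inner ℝ n z) hsum
      simp only [inner_add_right, inner_smul_right, inner_sub_right, hpn, hqn] at h
      have h' : u * inner ℝ n n = 0 := by linarith
      exact (mul_eq_zero.1 h').resolve_right (real_inner_self_pos.2 hn).ne'
    refine ⟨(w - s - t) / e 0, s / e 2, t / e 4, ?_, ?_⟩
    · rw [div_mul_cancel₀ _ e0.ne', div_mul_cancel₀ _ e2.ne', div_mul_cancel₀ _ e4.ne',
        ← sub_add_cancel q (w • p 0), ← hsum, hu0]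
      module
    · field_simp
      ring
  have hpp : ∀ i, inner ℝ (p i) (p i) = r ^ 2 := fun i => by
    rw [real_inner_self_eq_norm_sq, hpr]
  have hlt : ∀ {i j : Fin 6}, i ≠ j → inner ℝ (p i) (p j) - r ^ 2 < 0 := by
    intro i j hij
    have h : 0 < inner ℝ (p i - p j) (p i - p j) := real_inner_self_pos.2 (sub_ne_zero.2 (hd hij))
    rw [inner_sub_left, inner_sub_right, inner_sub_right, hpp, hpp, real_inner_comm] at h
    rw [real_inner_comm]
    linarith
  -- Use the Lorentzian form `⟪x, y⟫ - r ^ 2 * s * t` on pairs `(x, s)`. The vectors `e i • (p i,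
  -- 1)` are null and `(q, w)` is a difference of two of them, so the product of `(q, w)` with the
  -- first of each pair is half its square, namely `M`.
  set M := (inner ℝ q q - r ^ 2 * w ^ 2) / 2 with hM
  have hnull : ∀ i j, e i • p i - e j • p j = q → e i - e j = w →
      e i * (inner ℝ (p i) q - r ^ 2 * w) = M := by
    intro i j h h'
    have hj : e j • p j = e i • p i - q := by rw [← h]; abel
    have hj2 : inner ℝ (e j • p j) (e j • p j) = (e i - w) ^ 2 * r ^ 2 := by
      rw [inner_smul_left, inner_smul_right, hpp, ← h', RCLike.conj_to_real]; ring
    rw [hj, inner_sub_left, inner_sub_right, inner_sub_right, inner_smul_left, inner_smul_left,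
      inner_smul_right, inner_smul_right, hpp] at hj2
    simp only [RCLike.conj_to_real, real_inner_comm q (p i)] at hj2 ⊢
    rw [hM]
    linear_combination (-1 / 2 : ℝ) * hj2
  have m0 := hnull 0 3 a1 a2
  have m2 := hnull 2 5 b1 b2
  have m4 := hnull 4 1 c1 c2
  have hM0 : 0 < M := by
    rw [← m0, ← a1, ← a2, inner_sub_right, inner_smul_right, inner_smul_right, hpp]
    have h3 := mul_pos (mul_pos e0 (hpos 3)) (neg_pos.2 (hlt (show (0 : Fin 6) ≠ 3 by decide)))
    linarith
  -- Expand one factor of the Lorentzian square of `(q, w)` in the vectors 0, 2, 4, each of which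
  -- has product `M` with it.
  have hqq : 2 * M = M * (qa + qb + qc) := by
    have h : inner ℝ q q = qa * e 0 * inner ℝ (p 0) q + qb * e 2 * inner ℝ (p 2) q +
        qc * e 4 * inner ℝ (p 4) q := by
      conv_lhs => enter [2]; rw [hq]
      simp only [inner_add_left, inner_smul_left, RCLike.conj_to_real]
    have h2 : 2 * M = inner ℝ q q - r ^ 2 * w ^ 2 := by rw [hM]; ring
    rw [h2, h]
    linear_combination qa * m0 + qb * m2 + qc * m4 - r ^ 2 * w * hw
  have hs : qa + qb + qc = 2 := by
    have : M * (qa + qb + qc - 2) = 0 := by linarith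
    linarith [(mul_eq_zero.1 this).resolve_left hM0.ne']
  have n02 := mul_neg_of_pos_of_neg (mul_pos e0 e2) (hlt (show (0 : Fin 6) ≠ 2 by decide))
  have n04 := mul_neg_of_pos_of_neg (mul_pos e0 e4) (hlt (show (0 : Fin 6) ≠ 4 by decide))
  have n24 := mul_neg_of_pos_of_neg (mul_pos e2 e4) (hlt (show (2 : Fin 6) ≠ 4 by decide))
  rw [hq] at m0 m2 m4
  simp only [inner_add_right, inner_smul_right, hpp, real_inner_comm (p 0) (p 2),
    real_inner_comm (p 0) (p 4), real_inner_comm (p 2) (p 4)] at m0 m2 m4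
  obtain ⟨k₀, k₁, k₂, hk⟩ := exists_goodDepths (signs_of_common_product n24 n04 n02 hM0
    (by rw [← m0, hw]; ring) (by rw [← m2, hw]; ring) (by rw [← m4, hw]; ring) hs)
  have hx := hk.trefoilSigns hpos hw a2 b2 c2
  set L : E3 ≃ₗ[ℝ] E3 := (WithLp.linearEquiv 2 ℝ (Fin 3 → ℝ)).trans B.equivFun.symm
  have hL : ∀ y : E3, L y = y 0 • (p 2 - p 0) + y 1 • (p 4 - p 0) + y 2 • n := by
    intro y
    change B.equivFun.symm y.ofLp = _
    rw [B.equivFun_symm_apply, Fin.sum_univ_three, hB]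
    rfl
  have e1 := hpos 1
  have e3 := hpos 3
  have e5 := hpos 5
  have hp3 : p 3 = (e 3)⁻¹ • (e 0 • p 0 - q) := by
    rw [← a1, sub_sub_cancel, inv_smul_smul₀ e3.ne']
  have hp5 : p 5 = (e 5)⁻¹ • (e 2 • p 2 - q) := by
    rw [← b1, sub_sub_cancel, inv_smul_smul₀ e5.ne']
  have hp1 : p 1 = (e 1)⁻¹ • (e 4 • p 4 - q) := by
    rw [← c1, sub_sub_cancel, inv_smul_smul₀ e1.ne']
  refine ⟨![0, -k₂ / e 1, 0, -k₀ / e 3, 0, -k₁ / e 5], _, hx.affine L (p 0) fun i => ?_⟩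
  rw [hL]
  fin_cases i
  · simp [weightedHexagon]
  · simp [weightedHexagon]
    rw [hp1, hq]
    (match_scalars <;> field_simp); linarith
  · simp [weightedHexagon]
  · simp [weightedHexagon]
    rw [hp3, hq]
    (match_scalars <;> field_simp); linarith
  · simp [weightedHexagon]
  · simp [weightedHexagon]
    rw [hp5, hq]
    (match_scalars <;> field_simp); linarith

/-! ### Shears and prescribed heights -/

/-- The linear map that adds to a vector its product with `v`, times `m`. -/
noncomputable def rankOneEquiv (v m : E3) (h : 1 + inner ℝ v m ≠ 0) : E3 ≃ₗ[ℝ] E3 :=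
  LinearEquiv.ofInjectiveEndo (LinearMap.id + (innerₗ E3 v).smulRight m) (by
    rw [← LinearMap.ker_eq_bot, LinearMap.ker_eq_bot']
    intro z hz
    have hz' : z + inner ℝ v z • m = 0 := by simpa using hz
    have h1 := congrArg (fun y => inner ℝ v y) hz'
    simp only [inner_add_right, inner_smul_right, inner_zero_right] at h1
    have h2 : inner ℝ v z * (1 + inner ℝ v m) = 0 := by linarith
    rw [(mul_eq_zero.1 h2).resolve_right h] at hz'
    simpa using hz')

@[simp] theorem rankOneEquiv_apply (v m : E3) (h : 1 + inner ℝ v m ≠ 0) (z : E3) :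
    rankOneEquiv v m h z = z + inner ℝ v z • m := by
  simp [rankOneEquiv]

/-- A shear along `n` and a translation add an affine function to the heights. On the two distinct
points `p i`, `p j` such a function takes arbitrary values. -/
theorem TrefoilSigns.exists_heights_eq {p : Fin 6 → E3} {n : E3}
    (hpn : ∀ i, inner ℝ n (p i) = 0) {H : Fin 6 → ℝ} {σ : ℝ}
    (h : TrefoilSigns σ fun i => p i + H i • n) {i j : Fin 6} (hij : p i ≠ p j) (a b : ℝ) :
    ∃ (H' : Fin 6 → ℝ) (σ' : ℝ), H' i = a ∧ H' j = b ∧ TrefoilSigns σ' fun k => p k + H' k • n := by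
  have hd : 0 < inner ℝ (p i - p j) (p i - p j) := real_inner_self_pos.2 (sub_ne_zero.2 hij)
  set κ := (a - H i - (b - H j)) / inner ℝ (p i - p j) (p i - p j) with hκ
  set v := κ • (p i - p j) with hv
  have hvn : inner ℝ v n = 0 := by
    rw [real_inner_comm, hv, inner_smul_right, inner_sub_right, hpn, hpn]
    simp
  have hvd : inner ℝ v (p i) - inner ℝ v (p j) = a - H i - (b - H j) := by
    rw [← inner_sub_right, hv, inner_smul_left, RCLike.conj_to_real, hκ, div_mul_cancel₀ _ hd.ne']
  set β := a - H i - inner ℝ v (p i) with hβ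
  refine ⟨fun k => H k + inner ℝ v (p k) + β, _, by simp only [hβ]; ring, by
    simp only [hβ]; linarith, h.affine (rankOneEquiv v n (by rw [hvn]; norm_num)) (β • n) ?_⟩
  intro k
  rw [rankOneEquiv_apply, inner_add_right, inner_smul_right, hvn]
  module

/-! ### Openness -/

theorem continuous_orient (i j k l : Fin 6) : Continuous fun x : Fin 6 → E3 => orient x i j k l := by
  simp only [orient, vol_eq]
  fun_prop

theorem isOpen_trefoilSigns (σ : ℝ) : IsOpen {x | TrefoilSigns σ x} := by
  have pos : ∀ i j k l, IsOpen {x : Fin 6 → E3 | 0 < σ * orient x i j k l} := fun i j k l =>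
    isOpen_lt continuous_const (continuous_const.mul (continuous_orient i j k l))
  have neg : ∀ i j k l, IsOpen {x : Fin 6 → E3 | σ * orient x i j k l < 0} := fun i j k l =>
    isOpen_lt (continuous_const.mul (continuous_orient i j k l)) continuous_const
  convert (((pos 0 1 2 3).inter (neg 0 1 3 4)).inter ((pos 0 1 4 5).inter (neg 1 2 3 4))).inter
    ((((neg 1 2 4 5).inter (neg 1 2 5 0)).inter ((pos 2 3 4 5).inter (neg 2 3 5 0))).inter
      (((neg 3 4 5 0).inter (neg 0 2 4 1)).inter ((neg 0 2 4 3).inter (neg 0 2 4 5)))) using 1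
  ext x
  exact ⟨fun h => ⟨⟨⟨h.s0123, h.s0134⟩, h.s0145, h.s1234⟩, ⟨⟨h.s1245, h.s1250⟩, h.s2345, h.s2350⟩,
    ⟨h.s3450, h.s0241⟩, h.s0243, h.s0245⟩,
    fun ⟨⟨⟨a, b⟩, c, d⟩, ⟨⟨e, f⟩, g, h⟩, ⟨i, j⟩, k, l⟩ => ⟨⟨a, b, c, d, e, f, g, h, i⟩, j, k, l⟩⟩

/-! ### Heights along an analytic curve -/

theorem IsAnalyticKnot.continuous {γ : ℝ → E3} (hγ : IsAnalyticKnot γ) : Continuous γ :=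
  continuous_iff_continuousAt.2 fun t => (hγ.analytic t).continuousAt

theorem IsAnalyticKnot.continuous_planeHeight {γ : ℝ → E3} (hγ : IsAnalyticKnot γ) (c n : E3) :
    Continuous fun u => planeHeight c n (γ u) := by
  have := hγ.continuous
  unfold planeHeight
  fun_prop

theorem coplanar_of_planeHeight_eq_zero {s : Set E3} {c n : E3} (hn : n ≠ 0)
    (h : ∀ x ∈ s, planeHeight c n x = 0) : Coplanar ℝ s := by
  have hle : vectorSpan ℝ s ≤ (ℝ ∙ n)ᗮ := by
    rw [vectorSpan_def, Submodule.span_le]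
    rintro _ ⟨x, hx, y, hy, rfl⟩
    rw [SetLike.mem_coe, Submodule.mem_orthogonal_singleton_iff_inner_right]
    have h1 := h x hx
    have h2 := h y hy
    rw [planeHeight] at h1 h2
    simp only [vsub_eq_sub]
    rw [← sub_sub_sub_cancel_right x y c, inner_sub_right, h1, h2, sub_zero]
  have hfin : Module.finrank ℝ (ℝ ∙ n)ᗮ = 2 := by
    have : Fact (Module.finrank ℝ E3 = 2 + 1) := ⟨by simp⟩
    exact Submodule.finrank_orthogonal_span_singleton hn
  rw [Coplanar]
  refine (Submodule.rank_mono hle).trans ?_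
  rw [← Module.finrank_eq_rank, hfin]
  norm_num

/-- By the identity theorem, an arc inside a plane would force the whole curve into it. -/
theorem IsAnalyticKnot.exists_planeHeight_ne_zero {γ : ℝ → E3} (hγ : IsAnalyticKnot γ)
    (hplane : ¬ Coplanar ℝ (range γ)) (c : E3) {n : E3} (hn : n ≠ 0) (t : ℝ) {η : ℝ} (hη : 0 < η) :
    ∃ u, |u - t| < η ∧ planeHeight c n (γ u) ≠ 0 := by
  by_contra! h
  have han : AnalyticOnNhd ℝ (fun u => planeHeight c n (γ u)) univ := fun u _ => by
    have h1 : AnalyticAt ℝ (fun u => γ u - c) u := (hγ.analytic u).sub analyticAt_const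
    exact ((innerSL ℝ n).analyticAt _).comp h1
  have hev : (fun u => planeHeight c n (γ u)) =ᶠ[nhds t] 0 := by
    filter_upwards [ball_mem_nhds t hη] with u hu
    exact h u hu
  have hzero := han.eqOn_zero_of_preconnected_of_eventuallyEq_zero isPreconnected_univ
    (mem_univ t) hev
  refine hplane (coplanar_of_planeHeight_eq_zero (c := c) hn ?_)
  rintro _ ⟨u, rfl⟩
  exact hzero (mem_univ u)

/-- Arbitrarily close to `t`, the curve has points on the side of the plane given by the sign of
`H`. -/
def ReachesSide (γ : ℝ → E3) (c n : E3) (t H : ℝ) : Prop :=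
  ∀ η > 0, ∃ u, |u - t| < η ∧ 0 < H * planeHeight c n (γ u)

theorem IsAnalyticKnot.exists_reachesSide {γ : ℝ → E3} (hγ : IsAnalyticKnot γ)
    (hplane : ¬ Coplanar ℝ (range γ)) (c : E3) {n : E3} (hn : n ≠ 0) (t : ℝ) :
    ∃ s, ReachesSide γ c n t s := by
  by_contra! h
  have h1 := h 1
  have h2 := h (-1)
  simp only [ReachesSide, not_forall, not_exists, not_and, not_lt] at h1 h2
  obtain ⟨η₁, hη₁, h1⟩ := h1
  obtain ⟨η₂, hη₂, h2⟩ := h2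
  obtain ⟨u, hu, hne⟩ := hγ.exists_planeHeight_ne_zero hplane c hn t (lt_min hη₁ hη₂)
  have := h1 u (hu.trans_le (min_le_left _ _))
  have := h2 u (hu.trans_le (min_le_right _ _))
  exact hne (by linarith)

theorem IsAnalyticKnot.reachesSide_of_not_isOneSided {γ : ℝ → E3} (hγ : IsAnalyticKnot γ)
    (hplane : ¬ Coplanar ℝ (range γ)) {c n : E3} (hn : n ≠ 0) {t : ℝ}
    (h0 : planeHeight c n (γ t) = 0) (ht : ¬ IsOneSided γ c n t) {H : ℝ} (hH : H ≠ 0) :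
    ReachesSide γ c n t H := by
  intro η hη
  obtain ⟨u, hu, hne⟩ := hγ.exists_planeHeight_ne_zero hplane c hn t hη
  have hmem : ∀ {v}, v ∈ Ioo (t - η) (t + η) ↔ |v - t| < η := by
    intro v
    rw [abs_lt, mem_Ioo]
    constructor <;> rintro ⟨_, _⟩ <;> constructor <;> linarith
  rw [IsOneSided, not_or] at ht
  have hboth : (∃ v, |v - t| < η ∧ 0 < planeHeight c n (γ v)) ∧
      ∃ v, |v - t| < η ∧ planeHeight c n (γ v) < 0 := by
    rcases lt_or_gt_of_ne hne with hneg | hpos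
    · refine ⟨?_, u, hu, hneg⟩
      by_contra hno
      refine ht.2 ⟨h0, t - η, t + η, by linarith, by linarith, ⟨u, hmem.2 hu, hneg⟩, ?_⟩
      rintro ⟨v, hv, hv'⟩
      exact hno ⟨v, hmem.1 hv, hv'⟩
    · refine ⟨⟨u, hu, hpos⟩, ?_⟩
      by_contra hno
      refine ht.1 ⟨h0, t - η, t + η, by linarith, by linarith, ⟨u, hmem.2 hu, hpos⟩, ?_⟩
      rintro ⟨v, hv, hv'⟩
      exact hno ⟨v, hmem.1 hv, hv'⟩
  rcases lt_or_gt_of_ne hH with hneg | hpos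
  · obtain ⟨v, hv, hv'⟩ := hboth.2
    exact ⟨v, hv, mul_pos_of_neg_of_neg hneg hv'⟩
  · obtain ⟨v, hv, hv'⟩ := hboth.1
    exact ⟨v, hv, mul_pos hpos hv'⟩

/-- The height vanishes at `t` and has the sign of `H` somewhere nearby, so it takes all small
values in between. Solvability for every small `ε` is what allows a common `ε` for six points. -/
theorem IsAnalyticKnot.exists_planeHeight_eq {γ : ℝ → E3} (hγ : IsAnalyticKnot γ) {c n : E3}
    {t H : ℝ} (h0 : planeHeight c n (γ t) = 0) (hH : H = 0 ∨ ReachesSide γ c n t H) {η : ℝ}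
    (hη : 0 < η) :
    ∃ ε₀ > 0, ∀ ε, 0 < ε → ε ≤ ε₀ → ∃ u, |u - t| < η ∧ planeHeight c n (γ u) = ε * H := by
  rcases hH with rfl | hH
  · exact ⟨1, one_pos, fun ε _ _ => ⟨t, by simpa using hη, by simpa using h0⟩⟩
  obtain ⟨u, hu, hpos⟩ := hH η hη
  have hH0 : H ≠ 0 := by rintro rfl; simp at hpos
  refine ⟨planeHeight c n (γ u) / H, ?_, fun ε hε hle => ?_⟩
  · rw [← mul_div_mul_left _ _ hH0]
    exact div_pos hpos (mul_self_pos.2 hH0)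
  have hmem : ε * H ∈ uIcc (planeHeight c n (γ t)) (planeHeight c n (γ u)) := by
    rw [h0, mem_uIcc, ← div_mul_cancel₀ (planeHeight c n (γ u)) hH0]
    rcases lt_or_gt_of_ne hH0 with h | h
    · exact Or.inr ⟨mul_le_mul_of_nonpos_right hle h.le, by nlinarith⟩
    · exact Or.inl ⟨by positivity, mul_le_mul_of_nonneg_right hle h.le⟩
  obtain ⟨v, hv, hv'⟩ := intermediate_value_uIcc
    (hγ.continuous_planeHeight c n).continuousOn hmem
  exact ⟨v, (abs_sub_left_of_mem_uIcc hv).trans_lt hu, hv'⟩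

/-! ### Perturbing the six points along the knot -/

theorem exists_pair_of_ncard_le_two {s : Set (Fin 6)} (h : s.ncard ≤ 2) :
    ∃ i j, i ≠ j ∧ s ⊆ {i, j} := by
  obtain ⟨T, hsT, hT⟩ := Finset.exists_superset_card_eq (s := s.toFinite.toFinset) (n := 2)
    (by rwa [← Set.ncard_eq_toFinset_card]) (by simp)
  obtain ⟨i, j, hij, rfl⟩ := Finset.card_eq_two.1 hT
  refine ⟨i, j, hij, fun k hk => ?_⟩
  simpa using hsT (s.toFinite.mem_toFinset.2 hk)

/-- Points at which the heights over a plane are small multiples of the heights of a hexagon with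
trefoil orientations also have trefoil orientations. -/
theorem trefoilSigns_of_rescaled_heights {c n m : E3} (hnm : inner ℝ n m = 1) {ε : ℝ} (hε : 0 < ε)
    {x : Fin 6 → E3} {H : Fin 6 → ℝ} (hx : ∀ k, planeHeight c n (x k) = ε * H k) {σ : ℝ}
    (h : TrefoilSigns σ fun k => x k - (ε * H k) • m + H k • m) : ∃ σ', TrefoilSigns σ' x := by
  have hL : 1 + inner ℝ ((ε - 1) • n) m ≠ 0 := by
    rw [inner_smul_left, hnm, RCLike.conj_to_real]
    linarith
  -- This map multiplies heights over the plane by `ε` and fixes the plane pointwise.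
  refine ⟨_, h.affine (rankOneEquiv ((ε - 1) • n) m hL) (-((ε - 1) * inner ℝ n c) • m) fun k => ?_⟩
  have hk := hx k
  rw [planeHeight, inner_sub_right] at hk
  have hk' : inner ℝ n (x k) = ε * H k + inner ℝ n c := by linarith
  rw [rankOneEquiv_apply, inner_smul_left, inner_add_right, inner_sub_right, inner_smul_right,
    inner_smul_right, hnm, hk', RCLike.conj_to_real]
  module

theorem mainTheorem9 (γ : ℝ → E3) (hγ : IsAnalyticKnot γ)
    (hplane : ¬ Coplanar ℝ (Set.range γ))
    (pole : S3)
    (t : Fin 6 → ℝ) (ht : StrictMono t) (ht_period : t 5 < t 0 + 1)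
    (hM₀ : (fun i => invStereo pole (γ (t i))) ∈ spaceM₀)
    (c n : E3) (hn : n ≠ 0) (r : ℝ) (hr : 0 < r)
    (hcircle : ∀ i, γ (t i) ∈ circleIn c n r)
    (hsided : {i : Fin 6 | IsOneSided γ c n (t i)}.ncard ≤ 2)
    (δ : ℝ) (hδ : 0 < δ) :
    ∃ t' : Fin 6 → ℝ, StrictMono t' ∧ t' 5 < t' 0 + 1 ∧ (∀ i, |t' i - t i| < δ) ∧
      FormsTrefoil (fun i => γ (t' i)) := by
  have hnn : 0 < inner ℝ n n := real_inner_self_pos.2 hn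
  set m := (inner ℝ n n)⁻¹ • n with hm
  have hnm : inner ℝ n m = 1 := by rw [hm, inner_smul_right, inv_mul_cancel₀ hnn.ne']
  have hm0 : m ≠ 0 := by
    intro h
    rw [h, inner_zero_right] at hnm
    exact zero_ne_one hnm
  set p : Fin 6 → E3 := fun i => γ (t i) - c with hp
  have hpn : ∀ i, inner ℝ n (p i) = 0 := fun i => (hcircle i).1
  have hpm : ∀ i, inner ℝ m (p i) = 0 := fun i => by
    rw [hm, inner_smul_left, hpn, mul_zero]
  have hpr : ∀ i, ‖p i‖ = r := fun i => by
    rw [hp, ← dist_eq_norm]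
    exact (hcircle i).2
  have hinj : Function.Injective p := by
    intro i j hij
    refine hM₀.1.1 ?_
    have : γ (t i) = γ (t j) := sub_left_injective hij
    simp only [this]
  obtain ⟨e, he⟩ := exists_hasCommonDifference_of_mem_spaceM hM₀.1
  have he' : HasCommonDifference p fun i => e i * (‖γ (t i)‖ ^ 2 + 4)⁻¹ := by
    obtain ⟨h0, q, w, ⟨a1, a2⟩, ⟨b1, b2⟩, c1, c2⟩ := he.of_invStereo
    -- Translating the points by `-c` changes each weighted difference by the same vector, since all
    -- differences of weights equal `w`.
    refine ⟨h0, q - w • c, w, ⟨?_, a2⟩, ⟨?_, b2⟩, ?_, c2⟩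
    · rw [← a1, ← a2]; simp only [hp]; module
    · rw [← b1, ← b2]; simp only [hp]; module
    · rw [← c1, ← c2]; simp only [hp]; module
  obtain ⟨H₀, σ₀, hH₀⟩ := exists_heights_trefoilSigns hm0 hpm hpr hinj he'
  obtain ⟨i, j, hij, hsub⟩ := exists_pair_of_ncard_le_two hsided
  choose s hs using fun k => hγ.exists_reachesSide hplane c hn (t k)
  -- All one-sided points are among `i` and `j`; their heights are set to values whose sign the
  -- curve reaches there.
  obtain ⟨H, σ, hHi, hHj, hH⟩ := hH₀.exists_heights_eq hpm (hinj.ne hij) (s i) (s j)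
  have hheight : ∀ k, planeHeight c n (γ (t k)) = 0 := fun k => (hcircle k).1
  have hreach : ∀ k, H k = 0 ∨ ReachesSide γ c n (t k) (H k) := by
    intro k
    by_cases hki : k = i
    · subst hki; exact Or.inr (hHi ▸ hs k)
    by_cases hkj : k = j
    · subst hkj; exact Or.inr (hHj ▸ hs k)
    rcases eq_or_ne (H k) 0 with h0 | h0
    · exact Or.inl h0
    · refine Or.inr (hγ.reachesSide_of_not_isOneSided hplane hn (hheight k) (fun hk => ?_) h0)
      rcases hsub hk with h | h
      exacts [hki h, hkj h]
  have hz : TrefoilSigns σ fun k => γ (t k) + H k • m := by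
    have h := hH.affine (LinearEquiv.refl ℝ E3) c (y := fun k => γ (t k) + H k • m) fun k => by
      simp only [hp, LinearEquiv.refl_apply]; abel
    simpa using h
  obtain ⟨ρ, hρ, hball⟩ := Metric.isOpen_iff.1 (isOpen_trefoilSigns σ) _ hz
  have hnear : ∀ᶠ u in nhds t, (StrictMono u ∧ u 5 < u 0 + 1) ∧ ∀ k,
      ‖γ (u k) - γ (t k)‖ < ρ / 2 := by
    refine Filter.Eventually.and (Filter.Eventually.and ?_ ?_) ?_
    · change ∀ᶠ u : Fin 6 → ℝ in nhds t, ∀ a b, a < b → u a < u b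
      refine Filter.eventually_all.2 fun a => Filter.eventually_all.2 fun b => ?_
      by_cases hab : a < b
      · filter_upwards [((continuous_apply a).tendsto t).eventually_lt
          ((continuous_apply b).tendsto t) (ht hab)] with u hu _ using hu
      · exact Filter.Eventually.of_forall fun u h => absurd h hab
    · exact ((continuous_apply 5).tendsto t).eventually_lt
        (((continuous_apply 0).add continuous_const).tendsto t) ht_period
    · refine Filter.eventually_all.2 fun k => ?_
      have hcont : Continuous fun u : Fin 6 → ℝ => ‖γ (u k) - γ (t k)‖ := by
        have := hγ.continuous
        fun_prop
      exact hcont.tendsto t |>.eventually_lt_const (by simpa using half_pos hρ)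
  obtain ⟨η, hη, hnear⟩ := Metric.eventually_nhds_iff.1 hnear
  choose ε₀ hε₀ hsol using fun k => hγ.exists_planeHeight_eq (hheight k) (hreach k)
    (lt_min hη hδ)
  set ε := Finset.univ.inf' Finset.univ_nonempty ε₀ with hεdef
  have hε : 0 < ε := (Finset.lt_inf'_iff _).2 fun k _ => hε₀ k
  choose u hu huH using fun k => hsol k ε hε (Finset.inf'_le _ (Finset.mem_univ k))
  obtain ⟨⟨hmono, hper⟩, hclose⟩ := hnear (y := u) ((dist_pi_lt_iff hη).2 fun k => by
    rw [Real.dist_eq]; exact (hu k).trans_le (min_le_left _ _))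
  refine ⟨u, hmono, hper, fun k => (hu k).trans_le (min_le_right _ _), ?_⟩
  have hmem : (fun k => γ (u k) - (ε * H k) • m + H k • m) ∈
      ball (fun k => γ (t k) + H k • m) ρ := by
    refine mem_ball.2 ((dist_pi_lt_iff hρ).2 fun k => ?_)
    -- The vector `(ε * H k) • m` is the normal component of the displacement `γ (u k) - γ (t k)`.
    have hnorm : ‖(ε * H k) • m‖ ≤ ‖γ (u k) - γ (t k)‖ := by
      have h1 : ε * H k = inner ℝ n (γ (u k) - γ (t k)) := by
        have h2 := hheight k
        rw [← huH k, planeHeight, ← sub_zero (inner ℝ n _), ← h2, planeHeight, ← inner_sub_right,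
          sub_sub_sub_cancel_right]
      have h3 : ‖n‖ * ‖m‖ = 1 := by
        have hn0 : ‖n‖ ≠ 0 := norm_ne_zero_iff.2 hn
        rw [hm, norm_smul, norm_inv, real_inner_self_eq_norm_sq, norm_pow, norm_norm]
        field_simp
      rw [h1, norm_smul]
      calc _ ≤ ‖n‖ * ‖γ (u k) - γ (t k)‖ * ‖m‖ := by
            gcongr; exact norm_inner_le_norm _ _
        _ = ‖n‖ * ‖m‖ * ‖γ (u k) - γ (t k)‖ := by ring
        _ = _ := by rw [h3, one_mul]
    rw [dist_eq_norm, add_sub_add_right_eq_sub, sub_right_comm]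
    calc _ ≤ ‖γ (u k) - γ (t k)‖ + ‖(ε * H k) • m‖ := norm_sub_le _ _
      _ < ρ := by linarith [hclose k]
  obtain ⟨σ', hσ'⟩ := trefoilSigns_of_rescaled_heights (x := fun k => γ (u k)) hnm hε huH
    (hball hmem)
  exact hσ'.formsTrefoil
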